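/- Let $n\in\mathbb{N}$ and let $I$ be a finite set of modes. For each $i\in I$ let there be given an integer $0\le m_i\le n$, reals $\lambda_{i,1},\dots,\lambda_{i,n}$ with $\lambda_{i,k}<0$ for $k\le m_i$ and $\lambda_{i,k}>0$ for $k>m_i$, an invertible matrix $S_i\in\mathbb{R}^{n\times n}$, and matrices $A_i,G_i\in\mathbb{R}^{n\times n}$. Put $L_i=S_i^{-1}\,\mathrm{diag}(\lambda_{i,1},\dots,\lambda_{i,n})\,S_i$, write $G_i=\begin{pmatrix}G_{i--}&G_{i-+}\\G_{i+-}&G_{i++}\end{pmatrix}$ in blocks of sizes $m_i$ and $n-m_i$, and set $$B_i^0=\begin{pmatrix}-G_{i--}&0\\-G_{i+-}&I_{n-m_i}\end{pmatrix}S_i,\qquad B_i^1=\begin{pmatrix}I_{m_i}&-G_{i-+}\\0&-G_{i++}\end{pmatrix}S_i .$$ A switching signal is a piecewise constant, right-continuous function $\sigma:\mathbb{R}_+\to I$ with finitely many discontinuities on every bounded interval. For a switching signal $\sigma$ and $w^0\in L^2((0,1);\mathbb{R}^n)$ consider the switched hyperbolic initial-boundary value problem $$\partial_t w+L_{\sigma(t)}\partial_x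 w=A_{\sigma(t)}w\quad(t\ge0,\ x\in[0,1]),\qquad B^0_{\sigma(t)}w(t,0)+B^1_{\sigma(t)}w(t,1)=0,\qquad w(0,\cdot)=w^0 .$$ A function $w\in C^0(\mathbb{R}_+;L^2((0,1);\mathbb{R}^n))$ is a weak solution of this problem if $w(0)=w^0$ and, for all $0\le a\le b$ and every $\mathbb{R}^n$-valued test function $\varphi$ of class $C^1$ (on $\mathbb{R}^2$) satisfying for every $t\in[a,b)$ the adjoint boundary condition $$\varphi(t,1)^\top L_{\sigma(t)}u_1=\varphi(t,0)^\top L_{\sigma(t)}u_0\quad\text{for all }u_0,u_1\in\mathbb{R}^n\text{ with }B^0_{\sigma(t)}u_0+B^1_{\sigma(t)}u_1=0,$$ one has $$\int_0^1\varphi(b,x)^\top w(b,x)\,dx-\int_0^1\varphi(a,x)^\top w(a,x)\,dx=\int_a^b\!\int_0^1\big(\partial_t\varphi+L_{\sigma(t)}^\top\partial_x\varphi+A_{\sigma(t)}^\top\varphi\big)^\top w\,dx\,dt .$$ Then for every switching signal $\sigma$ and every $w^0\in L^2((0,1);\mathbb{R}^n)$ there exists a unique weak solution $w\in C^0(\mathbb{R}_+;L^2((0,1);\mathbb{R}^n))$.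 Moreover, $w$ is the concatenation of unswitched solutions: whenever $a<b$ and $\sigma\equiv i$ on $[a,b)$, there is a weak solution $v$ of the unswitched problem for the single mode $i$ (constant signal $i$) with initial datum $w(a)$ such that $w(t)=v(t-a)$ for all $t\in[a,b]$. -/

import Mathlib

open MeasureTheory Set Filter Topology
open scoped NNReal

noncomputable section

namespace SwitchedHyperbolic

/-- `L²((0,1); ℝⁿ)`, with `ℝⁿ` carrying the Euclidean norm. -/
abbrev L2 (n : ℕ) : Type :=
  Lp (EuclideanSpace ℝ (Fin n)) 2 (volume.restrict (Ioo (0 : ℝ) 1))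

/-- The data of one mode. The first `m` characteristic speeds are negative, the remaining ones
are positive, and the columns of `S⁻¹` are the corresponding right eigenvectors of
`S⁻¹ diag(lam) S`, the matrix in front of `∂ₓ`. -/
structure Mode (n : ℕ) where
  /-- number of negative characteristic speeds -/
  m : ℕ
  m_le : m ≤ n
  /-- characteristic speeds -/
  lam : Fin n → ℝ
  lam_neg : ∀ k : Fin n, (k : ℕ) < m → lam k < 0
  lam_pos : ∀ k : Fin n, m ≤ (k : ℕ) → 0 < lam k
  /-- change of variables to characteristic coordinates -/
  S : Matrix (Fin n) (Fin n) ℝ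
  S_isUnit : IsUnit S
  /-- source term -/
  A : Matrix (Fin n) (Fin n) ℝ
  /-- boundary coupling in characteristic coordinates -/
  G : Matrix (Fin n) (Fin n) ℝ

namespace Mode

variable {n : ℕ}

/-- `L = S⁻¹ diag(lam) S`. -/
def L (P : Mode n) : Matrix (Fin n) (Fin n) ℝ :=
  P.S⁻¹ * Matrix.diagonal P.lam * P.S

/-- The block matrix `[[-G₋₋, 0], [-G₊₋, I]]`, written column by column: the first `m` columns
are those of `-G`, the others are those of the identity. -/
def G0 (P : Mode n) : Matrix (Fin n) (Fin n) ℝ :=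
  Matrix.of fun j k => if (k : ℕ) < P.m then -P.G j k else (1 : Matrix (Fin n) (Fin n) ℝ) j k

/-- The block matrix `[[I, -G₋₊], [0, -G₊₊]]`, written column by column: the first `m` columns
are those of the identity, the others are those of `-G`. -/
def G1 (P : Mode n) : Matrix (Fin n) (Fin n) ℝ :=
  Matrix.of fun j k => if (k : ℕ) < P.m then (1 : Matrix (Fin n) (Fin n) ℝ) j k else -P.G j k

/-- `B⁰ = G⁰ S`. -/
def B0 (P : Mode n) : Matrix (Fin n) (Fin n) ℝ := P.G0 * P.S

/-- `B¹ = G¹ S`. -/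
def B1 (P : Mode n) : Matrix (Fin n) (Fin n) ℝ := P.G1 * P.S

/-- The boundary condition `B⁰ u₀ + B¹ u₁ = 0` for the values `u₀` at `x = 0`, `u₁` at `x = 1`. -/
def BoundaryCondition (P : Mode n) (u₀ u₁ : EuclideanSpace ℝ (Fin n)) : Prop :=
  P.B0.toEuclideanLin u₀ + P.B1.toEuclideanLin u₁ = 0

/-- The adjoint boundary condition for the values `p₀` (at `x = 0`) and `p₁` (at `x = 1`) of a
test function: the boundary term `p · L u` of the integration by parts in `x` takes the same value
at both ends for all `u₀`, `u₁` that satisfy the boundary condition. -/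
def AdjointBoundaryCondition (P : Mode n) (p₀ p₁ : EuclideanSpace ℝ (Fin n)) : Prop :=
  ∀ u₀ u₁ : EuclideanSpace ℝ (Fin n), P.BoundaryCondition u₀ u₁ →
    inner ℝ p₁ (P.L.toEuclideanLin u₁) = inner ℝ p₀ (P.L.toEuclideanLin u₀)

/-- The formal adjoint operator `∂ₜ φ + Lᵀ ∂ₓ φ + Aᵀ φ` at the point `(t, x)`. -/
def adjointOperator (P : Mode n) (φ : ℝ → ℝ → EuclideanSpace ℝ (Fin n)) (t x : ℝ) :
    EuclideanSpace ℝ (Fin n) :=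
  deriv (fun s => φ s x) t + P.L.transpose.toEuclideanLin (deriv (fun y => φ t y) x)
    + P.A.transpose.toEuclideanLin (φ t x)

end Mode

/-- The discontinuities (switching times) of `σ`, the set of modes being discrete. -/
def switchingTimes {I : Type*} (σ : ℝ≥0 → I) : Set ℝ≥0 :=
  {t | ¬ ∀ᶠ s in 𝓝 t, σ s = σ t}

/-- Right-continuous, with finitely many discontinuities on every bounded interval. As the set of
modes is discrete, such a signal is constant between consecutive discontinuities. -/
structure IsSwitchingSignal {I : Type*} (σ : ℝ≥0 → I) : Prop where
  right_continuous : ∀ t, ∀ᶠ s in 𝓝[≥] t, σ s = σ t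
  finite_switchingTimes : ∀ T : ℝ≥0, (switchingTimes σ ∩ Iic T).Finite

/-- `w ∈ C⁰(ℝ₊; L²((0,1); ℝⁿ))` is a weak solution of
`∂ₜ w + L_σ(t) ∂ₓ w = A_σ(t) w`, `B⁰_σ(t) w(t,0) + B¹_σ(t) w(t,1) = 0`, `w(0,·) = w⁰`:
the initial condition holds, and the equation, multiplied by a `C¹` test function that satisfies
the adjoint boundary condition of the active mode and integrated by parts over
`[a,b] × [0,1]`, holds for all `0 ≤ a ≤ b`. -/
structure IsWeakSolution {n : ℕ} {I : Type*} (P : I → Mode n) (σ : ℝ≥0 → I) (w₀ : L2 n)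
    (w : C(ℝ≥0, L2 n)) : Prop where
  initial : w 0 = w₀
  weak_form : ∀ (a b : ℝ≥0), a ≤ b → ∀ φ : ℝ → ℝ → EuclideanSpace ℝ (Fin n),
    ContDiff ℝ 1 (fun q : ℝ × ℝ => φ q.1 q.2) →
    (∀ t ∈ Ico a b, (P (σ t)).AdjointBoundaryCondition (φ t 0) (φ t 1)) →
    (∫ x in Ioo (0 : ℝ) 1, inner ℝ (φ b x) (w b x))
        - (∫ x in Ioo (0 : ℝ) 1, inner ℝ (φ a x) (w a x))
      = ∫ t in (a : ℝ)..b, ∫ x in Ioo (0 : ℝ) 1,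
          inner ℝ ((P (σ t.toNNReal)).adjointOperator φ t x) (w t.toNNReal x)

end SwitchedHyperbolic

end

/-! On an interval where the mode is fixed, the weak formulation says that `w` is a weak orbit of
the adjoint of `η ↦ Lᵀη' + Aᵀη`, taken on C¹ functions `η` that satisfy the adjoint boundary
condition. Everything rests on this operator being quasi-dissipative, in a suitable norm, with `l`
minus it of dense range for large `l`; the semigroup theory is then developed by hand from these two
facts.

In dual characteristic variables `S⁻ᵀη` the transport part is diagonal, and the boundary condition
gives the values at one end of each characteristic by those at the other ends. This coupling may
amplify energy. Exponential weights absorb the amplification (`dissipative_transport`) at the cost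
of a positive growth rate. The resolvent equation is a family of scalar linear ODEs, coupled only
through a finite linear system for boundary values, solvable by the same estimate
(`exists_test_eq`). The source term is a bounded perturbation (`addBounded`).

For such an operator the adjoint has bounded resolvents, and its Yosida approximations converge to
weak orbits (`DissipativePair.exists_orbit`). Uniqueness (`DissipativePair.orbit_unique`) is an
energy estimate for the time integral of the orbit, which lies in the domain of the adjoint.

Time-independent test functions are enough to determine the orbit, and they imply the identity for
time-dependent ones by freezing the test function at each instant (`Stationary.weak`). For a
switching signal, the orbits are glued by continuous induction: right-continuity lets a solution be
continued past any time, and local finiteness of the switching times lets it reach limit times. -/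

noncomputable section

/-! ### Resolvents of the adjoint of a quasi-dissipative operator. -/

namespace SwitchedHyperbolic

/-- A family of test vectors `v`, each with its image `p v` in the Hilbert space `K` and the image
`q v` of `p v` under a quasi-dissipative operator for which `l - q` has dense range for all large
`l`. The adjoint of this operator generates a strongly continuous semigroup on `K`. -/
structure DissipativePair (K V : Type*) [NormedAddCommGroup K] [InnerProductSpace ℝ K]
    [AddCommGroup V] [Module ℝ V] where
  /-- the test vectors as elements of `K` -/
  p : V →ₗ[ℝ] K
  /-- their images under the dissipative operator -/
  q : V →ₗ[ℝ] K
  /-- the growth rate -/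
  ω : ℝ
  ω_nonneg : 0 ≤ ω
  separating : ∀ f : K, (∀ v, inner ℝ (p v) f = 0) → f = 0
  dissipative : ∀ v, inner ℝ (p v) (q v) ≤ ω * ‖p v‖ ^ 2
  denseRange : ∀ l, ω < l → DenseRange (l • p - q)

/-- Energy estimate: Grönwall's inequality for the square of the norm. -/
theorem norm_sq_le_of_inner_deriv_le {K : Type*} [NormedAddCommGroup K] [InnerProductSpace ℝ K]
    {f f' : ℝ → K} {T k ε : ℝ} (hk : 0 ≤ k) (hε : 0 ≤ ε)
    (hf : ∀ t, HasDerivAt f (f' t) t)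
    (hle : ∀ t ∈ Icc 0 T, 2 * inner ℝ (f t) (f' t) ≤ k * ‖f t‖ ^ 2 + ε) {t : ℝ}
    (ht : t ∈ Icc 0 T) :
    ‖f t‖ ^ 2 ≤ Real.exp (k * t) * (‖f 0‖ ^ 2 + ε * t) := by
  have hd : ∀ t, HasDerivAt (fun s => Real.exp (-k * s) * ‖f s‖ ^ 2 - ε * s)
      ((Real.exp (-k * t) * (-k)) * ‖f t‖ ^ 2 + Real.exp (-k * t) * (2 * inner ℝ (f t) (f' t))
        - ε) t := by
    intro t
    have h1 : HasDerivAt (fun s => Real.exp (-k * s)) (Real.exp (-k * t) * (-k)) t := by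
      simpa using ((hasDerivAt_id t).const_mul (-k)).exp
    have h2 : HasDerivAt (fun s => ε * s) ε t := by
      simpa using (hasDerivAt_id t).const_mul ε
    exact (h1.mul (hf t).norm_sq).sub h2
  have hanti : AntitoneOn (fun s => Real.exp (-k * s) * ‖f s‖ ^ 2 - ε * s) (Icc 0 T) := by
    refine antitoneOn_of_deriv_nonpos (convex_Icc 0 T)
      (fun t _ => (hd t).continuousAt.continuousWithinAt)
      (fun t _ => (hd t).differentiableAt.differentiableWithinAt) fun t ht => ?_
    rw [interior_Icc] at ht
    have hT := Ioo_subset_Icc_self ht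
    rw [(hd t).deriv]
    have h1 : Real.exp (-k * t) ≤ 1 := by
      rw [Real.exp_le_one_iff]; nlinarith [hT.1]
    have h0 := Real.exp_pos (-k * t)
    have := hle t hT
    nlinarith [mul_le_mul_of_nonneg_left this h0.le, mul_le_mul_of_nonneg_right h1 hε]
  have h := hanti (left_mem_Icc.2 (ht.1.trans ht.2)) ht ht.1
  simp only [mul_zero, Real.exp_zero, one_mul, sub_zero] at h
  have h3 : Real.exp (k * t) * Real.exp (-k * t) = 1 := by
    rw [← Real.exp_add]; simp
  calc ‖f t‖ ^ 2 = Real.exp (k * t) * (Real.exp (-k * t) * ‖f t‖ ^ 2) := by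
        rw [← mul_assoc, h3, one_mul]
    _ ≤ _ := by gcongr; linarith

namespace DissipativePair

variable {K V : Type*} [NormedAddCommGroup K] [InnerProductSpace ℝ K] [AddCommGroup V]
  [Module ℝ V] (D : DissipativePair K V)

/-- Dissipativity combined with Cauchy–Schwarz. The bound makes `(l p - q) v ↦ p v` well defined and
bounded on a dense subspace, so that it extends to `K`; the adjoint of the extension is `R`. -/
theorem norm_p_le {l : ℝ} (hl : D.ω < l) (v : V) :
    ‖D.p v‖ ≤ (l - D.ω)⁻¹ * ‖(l • D.p - D.q) v‖ := by
  have h1 : (l - D.ω) * ‖D.p v‖ ^ 2 ≤ ‖D.p v‖ * ‖(l • D.p - D.q) v‖ := by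
    refine le_trans ?_ (real_inner_le_norm (D.p v) _)
    simp only [LinearMap.sub_apply, LinearMap.smul_apply, inner_sub_right, inner_smul_right,
      real_inner_self_eq_norm_sq]
    nlinarith [D.dissipative v]
  have h0 : 0 < l - D.ω := by linarith
  rw [inv_mul_eq_div, le_div_iff₀ h0]
  rcases (norm_nonneg (D.p v)).eq_or_lt with h | h
  · rw [← h]; simp
  · nlinarith

theorem eq_of_forall_inner_eq {l : ℝ} (hl : D.ω < l) {u w : K}
    (h : ∀ v, inner ℝ ((l • D.p - D.q) v) u = inner ℝ ((l • D.p - D.q) v) w) : u = w := by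
  refine (D.denseRange l hl).eq_of_inner_left ℝ ?_
  intro v
  rw [real_inner_comm, h, real_inner_comm]

variable [CompleteSpace K]

/-- The resolvent of the adjoint of the dissipative operator. -/
def R (l : ℝ) : K →L[ℝ] K := ContinuousLinearMap.adjoint (D.p.extendOfNorm (l • D.p - D.q))

theorem inner_R {l : ℝ} (hl : D.ω < l) (v : V) (f : K) :
    inner ℝ ((l • D.p - D.q) v) (D.R l f) = inner ℝ (D.p v) f := by
  rw [R, ContinuousLinearMap.adjoint_inner_right,
    LinearMap.extendOfNorm_eq (D.denseRange l hl) ⟨_, D.norm_p_le hl⟩]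

theorem norm_R_le {l : ℝ} (hl : D.ω < l) : ‖D.R l‖ ≤ (l - D.ω)⁻¹ := by
  rw [R, LinearIsometryEquiv.norm_map]
  exact LinearMap.opNorm_extendOfNorm_le (D.denseRange l hl)
    (inv_nonneg.2 (by linarith)) (D.norm_p_le hl)

theorem norm_R_apply_le {l : ℝ} (hl : D.ω < l) (f : K) : (l - D.ω) * ‖D.R l f‖ ≤ ‖f‖ := by
  have h0 : 0 < l - D.ω := by linarith
  have := (D.R l).le_of_opNorm_le (D.norm_R_le hl) f
  rw [inv_mul_eq_div, le_div_iff₀ h0] at this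
  linarith

theorem eq_R {l : ℝ} (hl : D.ω < l) {u f : K}
    (h : ∀ v, inner ℝ ((l • D.p - D.q) v) u = inner ℝ (D.p v) f) : u = D.R l f :=
  D.eq_of_forall_inner_eq hl fun v => by rw [h, D.inner_R hl]

theorem R_injective {l : ℝ} (hl : D.ω < l) {f : K} (h : D.R l f = 0) : f = 0 :=
  D.separating f fun v => by rw [← D.inner_R hl, h, inner_zero_right]

/-- The resolvent identity, in a form that avoids mentioning the unbounded operator. -/
theorem R_eq_R {l m : ℝ} (hl : D.ω < l) (hm : D.ω < m) (f : K) :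
    D.R m f = D.R l (f + (l - m) • D.R m f) := by
  refine D.eq_R hl fun v => ?_
  have h := D.inner_R hm v f
  simp only [LinearMap.sub_apply, LinearMap.smul_apply, inner_sub_left, inner_smul_left,
    inner_add_right, inner_smul_right] at h ⊢
  simp only [RCLike.conj_to_real] at *
  linarith

theorem commute_R {l m : ℝ} (hl : D.ω < l) (hm : D.ω < m) : Commute (D.R l) (D.R m) := by
  rcases eq_or_ne l m with rfl | hne
  · exact Commute.refl _
  ext f
  have h1 := D.R_eq_R hl hm f
  have h2 := D.R_eq_R hm hl f
  simp only [map_add, map_smul] at h1 h2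
  have h3 : (l - m) • (D.R l (D.R m f)) = (l - m) • (D.R m (D.R l f)) := by
    have e1 : (l - m) • (D.R l (D.R m f)) = D.R m f - D.R l f := by
      rw [eq_sub_iff_add_eq, add_comm, ← h1]
    have e2 : (m - l) • (D.R m (D.R l f)) = D.R l f - D.R m f := by
      rw [eq_sub_iff_add_eq, add_comm, ← h2]
    rw [e1, ← neg_sub m l, neg_smul, e2, neg_sub]
  exact smul_right_injective K (sub_ne_zero.2 hne) h3

/-- The adjoint operator sends `u = R l f` to `l u - f = -g`. Since `u = R m (g + m u)` for every `m
> ω`, the bound on `R m` gives `(m - ω)‖u‖ ≤ ‖g + m u‖`; squaring and letting `m → ∞` leaves the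
claim. -/
theorem R_dissipative {l : ℝ} (hl : D.ω < l) (f : K) :
    inner ℝ (D.R l f) (l • D.R l f - f) ≤ D.ω * ‖D.R l f‖ ^ 2 := by
  set u := D.R l f with hu
  set g := f - l • u with hg
  have key : ∀ m, D.ω < m → -‖g‖ ^ 2 ≤ 2 * m * (inner ℝ u g + D.ω * ‖u‖ ^ 2) := by
    intro m hm
    have h1 : u = D.R m (g + m • u) := by
      have e : g + m • u = f + (m - l) • u := by rw [hg]; module
      rw [e]; exact D.R_eq_R hm hl f
    have h2 := D.norm_R_apply_le hm (g + m • u)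
    rw [← h1] at h2
    have h3 : ((m - D.ω) * ‖u‖) ^ 2 ≤ ‖g + m • u‖ ^ 2 :=
      pow_le_pow_left₀ (mul_nonneg (by linarith) (norm_nonneg _)) h2 2
    rw [norm_add_sq_real, inner_smul_right, norm_smul, mul_pow _ ‖u‖,
      Real.norm_eq_abs, mul_pow |m|, sq_abs, real_inner_comm] at h3
    nlinarith [mul_nonneg (sq_nonneg D.ω) (sq_nonneg ‖u‖)]
  have : 0 ≤ inner ℝ u g + D.ω * ‖u‖ ^ 2 := by
    by_contra! hneg
    set c := -(inner ℝ u g + D.ω * ‖u‖ ^ 2) with hc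
    have hc0 : 0 < c := by linarith
    have h2 : 0 ≤ ‖g‖ ^ 2 / c := by positivity
    -- Large enough that `2 m c` exceeds `‖g‖ ^ 2`.
    have h1 := key (D.ω + 1 + ‖g‖ ^ 2 / c) (by linarith)
    have h3 : ‖g‖ ^ 2 / c * c = ‖g‖ ^ 2 := div_mul_cancel₀ _ hc0.ne'
    have h4 : inner ℝ u g + D.ω * ‖u‖ ^ 2 = -c := by rw [hc]; ring
    rw [h4] at h1
    nlinarith [mul_nonneg D.ω_nonneg hc0.le, sq_nonneg ‖g‖]
  have h4 : l • u - f = -g := by rw [hg]; abel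
  rw [h4, inner_neg_right]
  linarith

/-- If `g` is orthogonal to the range, then `⟨R g, g⟩ = 0`, and dissipativity reads `l‖R g‖² ≤ ω‖R
g‖²`; hence `R g = 0` and `g = 0`. -/
theorem denseRange_R {l : ℝ} (hl : D.ω < l) : DenseRange (D.R l) := by
  have : (LinearMap.range (D.R l).toLinearMap).topologicalClosure = ⊤ := by
    rw [Submodule.topologicalClosure_eq_top_iff, Submodule.eq_bot_iff]
    intro g hg
    have h0 : inner ℝ (D.R l g) g = 0 := (Submodule.mem_orthogonal _ _).1 hg _ ⟨g, rfl⟩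
    have h1 := D.R_dissipative hl g
    rw [inner_sub_right, inner_smul_right, h0, real_inner_self_eq_norm_sq] at h1
    refine D.R_injective hl (norm_eq_zero.1 ?_)
    have : ‖D.R l g‖ ^ 2 ≤ 0 := by nlinarith [sq_nonneg ‖D.R l g‖]
    exact pow_eq_zero_iff (two_ne_zero) |>.1 (le_antisymm this (sq_nonneg _))
  rw [DenseRange, dense_iff_closure_eq]
  exact congrArg (fun s : Submodule ℝ K => (s : Set K)) this

end DissipativePair
end SwitchedHyperbolic

/-! ### Weak orbits: uniqueness, Yosida approximation, bounded perturbations. -/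

namespace SwitchedHyperbolic
namespace DissipativePair

variable {K V : Type*} [NormedAddCommGroup K] [InnerProductSpace ℝ K] [AddCommGroup V]
  [Module ℝ V] (D : DissipativePair K V)

/-- The parameters of the Yosida approximations. -/
def index (k : ℕ) : ℝ := 2 * D.ω + 1 + k

theorem lt_index (k : ℕ) : D.ω < D.index k := by
  have := D.ω_nonneg; have : (0 : ℝ) ≤ k := k.cast_nonneg
  unfold index; linarith

theorem two_mul_le_index (k : ℕ) : 2 * D.ω ≤ D.index k := by
  have : (0 : ℝ) ≤ k := k.cast_nonneg
  unfold index; linarith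

variable [CompleteSpace K]

/-- The orbit itself need not lie in the domain of the adjoint, but its primitive `W` does, and the
adjoint sends `W` to `u = W'`. The energy estimate for `W` gives `W = 0`, and injectivity of the
resolvent then gives `u = 0`. -/
theorem orbit_unique {u : ℝ → K} (hu : Continuous u) {T : ℝ}
    (h : ∀ v, ∀ t ∈ Icc 0 T, inner ℝ (D.p v) (u t) = ∫ s in (0 : ℝ)..t, inner ℝ (D.q v) (u s))
    {t : ℝ} (ht : t ∈ Icc 0 T) : u t = 0 := by
  set W : ℝ → K := fun t => ∫ s in (0 : ℝ)..t, u s with hW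
  have hWd : ∀ t, HasDerivAt W (u t) t := fun t =>
    intervalIntegral.integral_hasDerivAt_right (hu.intervalIntegrable _ _)
      (hu.stronglyMeasurableAtFilter _ _) hu.continuousAt
  have hl : D.ω < D.ω + 1 := by linarith
  have hWR : ∀ t ∈ Icc 0 T, W t = D.R (D.ω + 1) ((D.ω + 1) • W t - u t) := by
    intro t ht
    refine D.eq_R hl fun v => ?_
    have h1 : inner ℝ (D.q v) (W t) = inner ℝ (D.p v) (u t) := by
      rw [h v t ht, hW]
      exact ((innerSL ℝ (D.q v)).intervalIntegral_comp_comm (hu.intervalIntegrable _ _)).symm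
    simp only [LinearMap.sub_apply, LinearMap.smul_apply, inner_sub_left, inner_smul_left,
      inner_sub_right, inner_smul_right, h1, RCLike.conj_to_real]
  have hW0 : ∀ t ∈ Icc 0 T, W t = 0 := by
    intro t ht
    have hle : ∀ t ∈ Icc 0 T, 2 * inner ℝ (W t) (u t) ≤ (2 * D.ω) * ‖W t‖ ^ 2 + 0 := by
      intro t ht
      have := D.R_dissipative hl ((D.ω + 1) • W t - u t)
      rw [← hWR t ht, sub_sub_cancel] at this
      linarith
    have := norm_sq_le_of_inner_deriv_le (by linarith [D.ω_nonneg]) le_rfl hWd hle ht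
    simp only [hW, intervalIntegral.integral_same, norm_zero] at this
    norm_num at this
    exact this
  have h1 := hWR t ht
  rw [hW0 t ht, smul_zero, zero_sub] at h1
  simpa using D.R_injective hl h1.symm

/-- The Yosida approximation of the adjoint of the dissipative operator. -/
def yosida (l : ℝ) : K →L[ℝ] K := l • (l • D.R l - 1)

/-- The semigroup generated by the Yosida approximation. -/
def approx (l t : ℝ) : K →L[ℝ] K := NormedSpace.exp (t • D.yosida l)

theorem approx_zero (l : ℝ) : D.approx l 0 = 1 := by
  simp [approx]

theorem hasDerivAt_approx (l t : ℝ) (x : K) :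
    HasDerivAt (fun s => D.approx l s x) (D.yosida l (D.approx l t x)) t := by
  have := (hasDerivAt_exp_smul_const' (𝕂 := ℝ) (D.yosida l) t).clm_apply (hasDerivAt_const t x)
  simpa [approx] using this

theorem commute_yosida {l m : ℝ} (hl : D.ω < l) (hm : D.ω < m) :
    Commute (D.yosida l) (D.yosida m) := by
  have h := D.commute_R hl hm
  exact ((((h.smul_left l).smul_right m).sub_left (Commute.one_left _)).sub_right
    ((Commute.one_right _))).smul_left l |>.smul_right m

theorem commute_yosida_approx {l m : ℝ} (hl : D.ω < l) (hm : D.ω < m) (t : ℝ) :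
    Commute (D.yosida m) (D.approx l t) :=
  ((D.commute_yosida hm hl).smul_right t).exp_right

/-- The natural growth rate is `l ω / (l - ω)`, which is at most `2 ω` once `l ≥ 2 ω`. -/
theorem inner_yosida_le {l : ℝ} (hl : D.ω < l) (hl2 : 2 * D.ω ≤ l) (x : K) :
    inner ℝ x (D.yosida l x) ≤ 2 * D.ω * ‖x‖ ^ 2 := by
  have h0 := D.ω_nonneg
  have h1 := D.norm_R_apply_le hl x
  have h2 := real_inner_le_norm x (D.R l x)
  have h3 : inner ℝ x (D.yosida l x) = l ^ 2 * inner ℝ x (D.R l x) - l * ‖x‖ ^ 2 := by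
    simp [yosida, inner_smul_right, inner_sub_right]
    ring
  have hpos : 0 < l - D.ω := by linarith
  rw [h3]
  have h4 : (l - D.ω) * inner ℝ x (D.R l x) ≤ ‖x‖ ^ 2 := by
    nlinarith [norm_nonneg x]
  refine le_of_mul_le_mul_left ?_ hpos
  nlinarith [mul_le_mul_of_nonneg_left h4 (sq_nonneg l),
    mul_nonneg (mul_nonneg h0 (by linarith : 0 ≤ l - 2 * D.ω)) (sq_nonneg ‖x‖)]

theorem norm_approx_le {l : ℝ} (hl : D.ω < l) (hl2 : 2 * D.ω ≤ l) {T t : ℝ} (ht : t ∈ Icc 0 T)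
    (x : K) : ‖D.approx l t x‖ ≤ Real.exp (2 * D.ω * T) * ‖x‖ := by
  have h := norm_sq_le_of_inner_deriv_le (f := fun s => D.approx l s x) (T := T) (k := 4 * D.ω)
    (ε := 0) (by linarith [D.ω_nonneg]) le_rfl (fun s => D.hasDerivAt_approx l s x)
    (fun s _ => by have := D.inner_yosida_le hl hl2 (D.approx l s x); linarith) ht
  simp only [approx_zero, one_apply_eq_self, zero_mul, add_zero] at h
  refine (sq_le_sq₀ (norm_nonneg _) (by positivity)).1 ?_
  rw [mul_pow, ← Real.exp_nat_mul]
  refine h.trans (mul_le_mul_of_nonneg_right (Real.exp_le_exp.2 ?_) (sq_nonneg _))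
  have := mul_le_mul_of_nonneg_left ht.2 D.ω_nonneg
  push_cast; linarith

/-- As the approximations commute, the difference `e` solves `e' = Y_m e + S_l(t)(Y_l x - Y_m x)`,
with `Y` the Yosida operators and `S` their semigroups. Grönwall applies after splitting `2‖e‖ε ≤
‖e‖² + ε²`, the source of the `+ 1` in the exponent. -/
theorem norm_approx_sub_approx_le {l m : ℝ} (hl : D.ω < l) (hl2 : 2 * D.ω ≤ l) (hm : D.ω < m)
    (hm2 : 2 * D.ω ≤ m) {T t : ℝ} (ht : t ∈ Icc 0 T) (x : K) :
    ‖D.approx l t x - D.approx m t x‖ ^ 2 ≤ Real.exp ((4 * D.ω + 1) * T) *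
      ((Real.exp (2 * D.ω * T) * ‖D.yosida l x - D.yosida m x‖) ^ 2 * T) := by
  have h0 := D.ω_nonneg
  have hT : 0 ≤ T := ht.1.trans ht.2
  set ε := Real.exp (2 * D.ω * T) * ‖D.yosida l x - D.yosida m x‖ with hε
  have h := norm_sq_le_of_inner_deriv_le (f := fun s => D.approx l s x - D.approx m s x) (T := T)
    (k := 4 * D.ω + 1) (ε := ε ^ 2) (by linarith) (sq_nonneg _)
    (fun s => (D.hasDerivAt_approx l s x).sub (D.hasDerivAt_approx m s x)) ?_ ht
  · simp only [approx_zero, sub_self, norm_zero] at h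
    refine h.trans ?_
    have := ht.2
    have := ht.1
    norm_num
    gcongr
  · intro s hs
    set e := D.approx l s x - D.approx m s x with he
    have h1 : D.yosida l (D.approx l s x) - D.yosida m (D.approx m s x)
        = D.yosida m e + D.approx l s (D.yosida l x - D.yosida m x) := by
      have c1 := congrArg (fun A : K →L[ℝ] K => A x) (D.commute_yosida_approx hl hl s).eq
      have c2 := congrArg (fun A : K →L[ℝ] K => A x) (D.commute_yosida_approx hl hm s).eq
      simp only [mul_apply_eq_comp] at c1 c2
      rw [he, map_sub, map_sub, ← c1, ← c2]; abel
    have h2 := D.norm_approx_le hl hl2 hs (D.yosida l x - D.yosida m x)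
    have h3 := D.inner_yosida_le hm hm2 e
    have h4 := real_inner_le_norm e (D.approx l s (D.yosida l x - D.yosida m x))
    rw [h1, inner_add_right]
    rw [← hε] at h2
    nlinarith [mul_le_mul_of_nonneg_left h2 (norm_nonneg e), sq_nonneg (‖e‖ - ε)]

theorem norm_index_smul_R_le (k : ℕ) (x : K) : ‖D.index k • D.R (D.index k) x‖ ≤ 2 * ‖x‖ := by
  have h1 := D.norm_R_apply_le (D.lt_index k) x
  have h2 := D.two_mul_le_index k
  have h3 := D.lt_index k
  have h4 := D.ω_nonneg
  rw [norm_smul, Real.norm_eq_abs, abs_of_pos (by linarith)]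
  nlinarith [norm_nonneg (D.R (D.index k) x)]

/-- On the dense range of a fixed resolvent, `l R_l z - z` is `R_l` applied to a fixed vector, hence
`O(1/l)`. The uniform bound `2` on `l R_l` extends the convergence to all of `K`. -/
theorem tendsto_index_smul_R (x : K) :
    Tendsto (fun k => D.index k • D.R (D.index k) x) atTop (𝓝 x) := by
  have hl : D.ω < D.ω + 1 := by linarith
  refine Metric.tendsto_atTop.2 fun ε hε => ?_
  obtain ⟨y, hy⟩ := (D.denseRange_R hl).exists_dist_lt x (show 0 < ε / 6 by positivity)
  set z := D.R (D.ω + 1) y with hz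
  set g := (D.ω + 1) • z - y with hg
  obtain ⟨N, hN⟩ := exists_nat_gt (‖g‖ / (ε / 2))
  refine ⟨N, fun k hk => ?_⟩
  have h1 : D.index k • D.R (D.index k) z - z = D.R (D.index k) g := by
    have := D.R_eq_R (D.lt_index k) hl y
    rw [← hz] at this
    conv_lhs => rw [this]
    rw [hg]
    nth_rw 1 [← this]
    simp only [map_add, map_sub, map_smul]
    module
  have h2 : ‖D.R (D.index k) g‖ < ε / 2 := by
    have h := D.norm_R_apply_le (D.lt_index k) g
    have hk' : (N : ℝ) ≤ k := by exact_mod_cast hk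
    have hi : (N : ℝ) < D.index k - D.ω := by unfold index; linarith [D.ω_nonneg]
    rw [div_lt_iff₀ (by positivity)] at hN
    by_contra! hc
    have : (N : ℝ) * (ε / 2) ≤ (D.index k - D.ω) * ‖D.R (D.index k) g‖ := by
      have : (0 : ℝ) ≤ N := N.cast_nonneg
      gcongr
      linarith
    linarith
  have h3 := D.norm_index_smul_R_le k (x - z)
  rw [dist_eq_norm] at hy ⊢
  have h4 : D.index k • D.R (D.index k) x - x = D.index k • D.R (D.index k) (x - z)
      + D.R (D.index k) g - (x - z) := by
    rw [← h1, map_sub, smul_sub]; abel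
  rw [h4]
  calc _ ≤ ‖D.index k • D.R (D.index k) (x - z)‖ + ‖D.R (D.index k) g‖ + ‖x - z‖ :=
        (norm_sub_le _ _).trans (by gcongr; exact norm_add_le _ _)
    _ < ε := by linarith

theorem tendsto_yosida_R {l : ℝ} (hl : D.ω < l) (y : K) :
    Tendsto (fun k => D.yosida (D.index k) (D.R l y)) atTop (𝓝 (l • D.R l y - y)) := by
  refine (D.tendsto_index_smul_R (l • D.R l y - y)).congr fun k => ?_
  have := D.R_eq_R (D.lt_index k) hl y
  simp only [map_add, map_smul] at this
  simp only [yosida, smul_apply, sub_apply, map_sub,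
    map_smul, one_apply_eq_self]
  congr 1
  nth_rw 3 [this]
  module

theorem uniformCauchySeqOn_approx (x : K) (T : ℝ) :
    UniformCauchySeqOn (fun k t => D.approx (D.index k) t x) atTop (Icc 0 T) := by
  rw [Metric.uniformCauchySeqOn_iff]
  intro ε hε
  have hl : D.ω < D.ω + 1 := by linarith
  set C := Real.exp (2 * D.ω * T) with hC
  have hC0 : 0 < C := Real.exp_pos _
  obtain ⟨y, hy⟩ := (D.denseRange_R hl).exists_dist_lt x (show 0 < ε / 3 / C by positivity)
  set z := D.R (D.ω + 1) y with hz
  have hcau := (D.tendsto_yosida_R hl y).cauchySeq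
  rw [← hz] at hcau
  set E := Real.exp ((4 * D.ω + 1) * T) with hE
  have hE0 : 0 < E := Real.exp_pos _
  obtain ⟨δ, hδ0, hδ⟩ : ∃ δ > 0, E * ((C * δ) ^ 2 * T) ≤ (ε / 4) ^ 2 := by
    -- Solves the inequality for `δ`, with `|T| + 1 > 0` in place of `T` since `T` may vanish or be
    -- negative.
    refine ⟨ε / 4 / C / Real.sqrt (E * (|T| + 1)), by positivity, ?_⟩
    have h1 : 0 < E * (|T| + 1) := by positivity
    have : (C * (ε / 4 / C / Real.sqrt (E * (|T| + 1)))) ^ 2 = (ε / 4) ^ 2 / (E * (|T| + 1)) := by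
      rw [← mul_div_assoc, mul_div_cancel₀ _ hC0.ne', div_pow, Real.sq_sqrt h1.le]
    rw [this, ← mul_assoc, mul_div_assoc', mul_comm, mul_div_assoc', div_le_iff₀ h1]
    have : T ≤ |T| + 1 := by linarith [le_abs_self T]
    nlinarith [mul_le_mul_of_nonneg_left this (by positivity : 0 ≤ E * (ε / 4) ^ 2)]
  obtain ⟨N, hN⟩ := Metric.cauchySeq_iff.1 hcau δ hδ0
  refine ⟨N, fun k hk j hj t ht => ?_⟩
  have hT : 0 ≤ T := ht.1.trans ht.2
  rw [dist_eq_norm] at hy ⊢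
  have hd := hN k hk j hj
  rw [dist_eq_norm] at hd
  have h1 : ‖D.approx (D.index k) t z - D.approx (D.index j) t z‖ ≤ ε / 4 := by
    refine (sq_le_sq₀ (norm_nonneg _) (by positivity)).1
      ((D.norm_approx_sub_approx_le (D.lt_index k) (D.two_mul_le_index k)
        (D.lt_index j) (D.two_mul_le_index j) ht z).trans (le_trans ?_ hδ))
    gcongr
  have h2 : ∀ i, ‖D.approx (D.index i) t (x - z)‖ ≤ ε / 3 := by
    intro i
    refine (D.norm_approx_le (D.lt_index i) (D.two_mul_le_index i) ht (x - z)).trans ?_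
    rw [lt_div_iff₀ hC0] at hy
    linarith
  have h3 : D.approx (D.index k) t x - D.approx (D.index j) t x
      = D.approx (D.index k) t (x - z) + (D.approx (D.index k) t z - D.approx (D.index j) t z)
        - D.approx (D.index j) t (x - z) := by
    simp only [map_sub]; abel
  rw [h3]
  calc _ ≤ ‖D.approx (D.index k) t (x - z)‖
        + ‖D.approx (D.index k) t z - D.approx (D.index j) t z‖
        + ‖D.approx (D.index j) t (x - z)‖ :=
        (norm_sub_le _ _).trans (by gcongr; exact norm_add_le _ _)
    _ < ε := by linarith [h2 k, h2 j]

/-- The unbounded part is moved onto the test vector; what remains on `x` is `l R_l`, which is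
uniformly bounded and tends to the identity, so the limit can be taken. -/
theorem inner_p_yosida (k : ℕ) (v : V) (x : K) :
    inner ℝ (D.p v) (D.yosida (D.index k) x)
      = inner ℝ (D.q v) (D.index k • D.R (D.index k) x) := by
  have h := D.inner_R (D.lt_index k) v x
  simp only [LinearMap.sub_apply, LinearMap.smul_apply, inner_sub_left, inner_smul_left,
    RCLike.conj_to_real] at h
  simp only [yosida, smul_apply, sub_apply,
    one_apply_eq_self, inner_smul_right, inner_sub_right]
  rw [← h]; ring

theorem exists_orbit (x : K) :
    ∃ u : ℝ → K, Continuous u ∧ u 0 = x ∧ ∀ v, ∀ t, 0 ≤ t →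
      inner ℝ (D.p v) (u t) - inner ℝ (D.p v) x = ∫ s in (0 : ℝ)..t, inner ℝ (D.q v) (u s) := by
  have hlim : ∀ t, ∃ y, 0 ≤ t → Tendsto (fun k => D.approx (D.index k) t x) atTop (𝓝 y) := by
    intro t
    by_cases ht : 0 ≤ t
    · obtain ⟨y, hy⟩ := cauchySeq_tendsto_of_complete
        ((D.uniformCauchySeqOn_approx x t).cauchySeq (right_mem_Icc.2 ht))
      exact ⟨y, fun _ => hy⟩
    · exact ⟨0, fun h => absurd h ht⟩
  choose U hU using hlim
  have happ : ∀ k, Continuous fun t => D.approx (D.index k) t x := fun k =>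
    continuous_iff_continuousAt.2 fun t => (D.hasDerivAt_approx _ t x).continuousAt
  have hUc : ∀ T, ContinuousOn U (Icc 0 T) := fun T =>
    ((D.uniformCauchySeqOn_approx x T).tendstoUniformlyOn_of_tendsto
      fun t ht => hU t ht.1).continuousOn (.of_forall fun k => (happ k).continuousOn)
  have hUc' : ContinuousOn U (Ici 0) := by
    intro t ht
    refine ((hUc (t + 1)) t ⟨ht, by linarith⟩).mono_of_mem_nhdsWithin ?_
    rw [← Ici_inter_Iic]
    exact inter_mem_nhdsWithin _ (Iic_mem_nhds (by linarith))
  have hU0 : U 0 = x := by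
    refine tendsto_nhds_unique (hU 0 le_rfl) ?_
    simp [approx_zero]
  -- Extended by a constant to negative times, so that the orbit is continuous on the whole line.
  refine ⟨fun t => U (max t 0), hUc'.comp_continuous (by fun_prop) fun t => le_max_right t 0,
    by simp [hU0], fun v t ht => ?_⟩
  have heq : ∀ k, inner ℝ (D.p v) (D.approx (D.index k) t x) - inner ℝ (D.p v) x
      = ∫ s in (0 : ℝ)..t,
        inner ℝ (D.q v) (D.index k • D.R (D.index k) (D.approx (D.index k) s x)) := by
    intro k
    have h := intervalIntegral.integral_eq_sub_of_hasDerivAt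
      (f := fun s => inner ℝ (D.p v) (D.approx (D.index k) s x)) (a := 0) (b := t)
      (f' := fun s => inner ℝ (D.p v) (D.yosida (D.index k) (D.approx (D.index k) s x)))
      (fun s _ => by
        have := (hasDerivAt_const s (D.p v)).inner ℝ (D.hasDerivAt_approx (D.index k) s x)
        simpa using this)
      (Continuous.intervalIntegrable (by have := happ k; fun_prop) _ _)
    simp only [approx_zero, one_apply_eq_self] at h
    rw [← h]
    simp only [D.inner_p_yosida]
  have hL : Tendsto (fun k => inner ℝ (D.p v) (D.approx (D.index k) t x) - inner ℝ (D.p v) x) atTop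
      (𝓝 (inner ℝ (D.p v) (U (max t 0)) - inner ℝ (D.p v) x)) := by
    rw [max_eq_left ht]
    exact (tendsto_const_nhds.inner (hU t ht)).sub_const _
  refine tendsto_nhds_unique hL ?_
  simp only [heq]
  refine intervalIntegral.tendsto_integral_filter_of_dominated_convergence
    (fun _ => ‖D.q v‖ * (2 * (Real.exp (2 * D.ω * t) * ‖x‖))) (.of_forall fun k => ?_)
    (.of_forall fun k => .of_forall fun s hs => ?_) intervalIntegrable_const
    (.of_forall fun s hs => ?_)
  · exact Continuous.aestronglyMeasurable (by have := happ k; fun_prop)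
  · rw [uIoc_of_le ht] at hs
    refine (norm_inner_le_norm _ _).trans ?_
    gcongr
    refine (D.norm_index_smul_R_le _ _).trans ?_
    gcongr
    exact D.norm_approx_le (D.lt_index k) (D.two_mul_le_index k) (Ioc_subset_Icc_self hs) x
  · rw [uIoc_of_le ht] at hs
    rw [max_eq_left hs.1.le]
    refine tendsto_const_nhds.inner ?_
    have h1 := D.tendsto_index_smul_R (U s)
    have h2 : Tendsto (fun k => D.index k • D.R (D.index k) (D.approx (D.index k) s x - U s))
        atTop (𝓝 0) := by
      refine squeeze_zero_norm (fun k => D.norm_index_smul_R_le k _) ?_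
      have := ((hU s hs.1.le).sub_const (U s)).norm.const_mul 2
      simpa using this
    have h3 := h2.add h1
    rw [zero_add] at h3
    refine h3.congr fun k => ?_
    rw [map_sub, smul_sub, sub_add_cancel]

/-- Adding a bounded operator to a quasi-dissipative operator. -/
def addBounded (B : K →L[ℝ] K) : DissipativePair K V where
  p := D.p
  q := D.q + B.toLinearMap ∘ₗ D.p
  ω := D.ω + ‖B‖
  ω_nonneg := add_nonneg D.ω_nonneg (norm_nonneg _)
  separating := D.separating
  dissipative v := by
    have h1 := D.dissipative v
    have h2 : inner ℝ (D.p v) (B (D.p v)) ≤ ‖B‖ * ‖D.p v‖ ^ 2 := by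
      refine (real_inner_le_norm _ _).trans ?_
      nlinarith [B.le_opNorm (D.p v), norm_nonneg (D.p v)]
    simp only [LinearMap.add_apply, LinearMap.comp_apply, inner_add_right]
    simp only [ContinuousLinearMap.coe_coe]
    linarith
  denseRange l hl := by
    have hlω : D.ω < l := by linarith [norm_nonneg B]
    have : (LinearMap.range
        (l • D.p - (D.q + B.toLinearMap ∘ₗ D.p))).topologicalClosure = ⊤ := by
      rw [Submodule.topologicalClosure_eq_top_iff, Submodule.eq_bot_iff]
      intro g hg
      -- A vector orthogonal to the range is a fixed point of `R_l B*`, a strict contraction because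
      -- `‖B‖ < l - ω`.
      have h1 : g = D.R l (ContinuousLinearMap.adjoint B g) := by
        refine D.eq_R hlω fun v => ?_
        have := (Submodule.mem_orthogonal _ _).1 hg _ ⟨v, rfl⟩
        rw [ContinuousLinearMap.adjoint_inner_right]
        simp only [LinearMap.add_apply, LinearMap.comp_apply, LinearMap.sub_apply,
          inner_sub_left, inner_add_left, ContinuousLinearMap.coe_coe] at this ⊢
        linarith
      have h2 := D.norm_R_apply_le hlω (ContinuousLinearMap.adjoint B g)
      rw [← h1] at h2
      have h3 := (ContinuousLinearMap.adjoint B).le_opNorm g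
      rw [LinearIsometryEquiv.norm_map] at h3
      by_contra hne
      have := norm_pos_iff.2 hne
      nlinarith
    rw [DenseRange, dense_iff_closure_eq]
    exact congrArg (fun s : Submodule ℝ K => (s : Set K)) this

end DissipativePair
end SwitchedHyperbolic

/-! ### Continuous functions and matrix multipliers in `L²`. -/

namespace SwitchedHyperbolic

theorem memLp_of_continuous {F : Type*} [NormedAddCommGroup F] {f : ℝ → F} (hf : Continuous f)
    (p : ENNReal) : MemLp f p (volume.restrict (Ioo (0 : ℝ) 1)) := by
  obtain ⟨C, hC⟩ := isCompact_Icc.exists_bound_of_continuousOn (s := Icc (0 : ℝ) 1) hf.continuousOn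
  exact MemLp.of_bound hf.aestronglyMeasurable C
    ((ae_restrict_mem measurableSet_Ioo).mono fun x hx => hC x (Ioo_subset_Icc_self hx))

variable {n : ℕ}

/-- The class in `L²((0,1); ℝⁿ)` of a continuous function. -/
def toL2 : C(ℝ, EuclideanSpace ℝ (Fin n)) →ₗ[ℝ] L2 n where
  toFun f := (memLp_of_continuous f.continuous 2).toLp f
  map_add' _ _ := rfl
  map_smul' _ _ := rfl

theorem coeFn_toL2 (f : C(ℝ, EuclideanSpace ℝ (Fin n))) :
    toL2 f =ᵐ[volume.restrict (Ioo (0 : ℝ) 1)] f := 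
  (memLp_of_continuous f.continuous 2).coeFn_toLp

theorem inner_toL2 (f : C(ℝ, EuclideanSpace ℝ (Fin n))) (w : L2 n) :
    inner ℝ (toL2 f) w = ∫ x in Ioo (0 : ℝ) 1, inner ℝ (f x) (w x) := by
  rw [L2.inner_def]
  refine integral_congr_ae ?_
  filter_upwards [coeFn_toL2 f] with x hx
  rw [hx]

theorem inner_toL2_toL2 (f g : C(ℝ, EuclideanSpace ℝ (Fin n))) :
    inner ℝ (toL2 f) (toL2 g) = ∫ x in (0 : ℝ)..1, inner ℝ (f x) (g x) := by
  rw [inner_toL2, intervalIntegral.integral_of_le zero_le_one, integral_Ioc_eq_integral_Ioo]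
  refine integral_congr_ae ?_
  filter_upwards [coeFn_toL2 g] with x hx
  rw [hx]

theorem norm_toL2_le {f : C(ℝ, EuclideanSpace ℝ (Fin n))} {C : ℝ} (hC : 0 ≤ C)
    (h : ∀ x ∈ Icc (0 : ℝ) 1, ‖f x‖ ≤ C) : ‖toL2 f‖ ≤ C := by
  have hae : ∀ᵐ x ∂(volume.restrict (Ioo (0 : ℝ) 1)), ‖toL2 f x‖ ≤ C := by
    filter_upwards [coeFn_toL2 f, ae_restrict_mem measurableSet_Ioo] with x hx hx'
    rw [hx]
    exact h x (Ioo_subset_Icc_self hx')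
  refine (Lp.norm_le_of_ae_bound hC hae).trans_eq ?_
  simp [measureUnivNNReal]

theorem denseRange_toL2 : DenseRange (toL2 (n := n)) := by
  refine (BoundedContinuousFunction.toLp_denseRange (EuclideanSpace ℝ (Fin n))
    (volume.restrict (Ioo (0 : ℝ) 1)) (p := 2) ℝ (by simp)).mono ?_
  rintro _ ⟨f, rfl⟩
  exact ⟨f.toContinuousMap, rfl⟩

/-- Functions vanishing at both ends satisfy any adjoint boundary condition, so this shows that the
test functions of every mode separate points of `L²`. -/
theorem eq_zero_of_inner_contDiff (f : L2 n)
    (h : ∀ (g : ℝ → ℝ) (hg : ContDiff ℝ 1 g) (e : EuclideanSpace ℝ (Fin n)), g 0 = 0 → g 1 = 0 →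
      inner ℝ (toL2 ⟨fun x => g x • e, hg.continuous.smul continuous_const⟩) f = 0) : f = 0 := by
  have hint : Integrable f (volume.restrict (Ioo (0 : ℝ) 1)) := (Lp.memLp f).integrable one_le_two
  have h0 := isOpen_Ioo.ae_eq_zero_of_integral_contDiff_smul_eq_zero (f := f)
    (μ := (volume.restrict (Ioo (0 : ℝ) 1))) (U := Ioo 0 1)
    (hint.locallyIntegrable.locallyIntegrableOn _) fun g hg hgc hgs => by
      have hg1 : ContDiff ℝ 1 g := hg.of_le (by exact_mod_cast le_top)
      refine ext_inner_left ℝ fun e => ?_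
      have h1 := h g hg1 e (image_eq_zero_of_notMem_tsupport fun h => by simpa using hgs h)
        (image_eq_zero_of_notMem_tsupport fun h => by simpa using hgs h)
      rw [inner_toL2] at h1
      have hgf : Integrable (fun x => g x • f x) (volume.restrict (Ioo (0 : ℝ) 1)) := by
        obtain ⟨C, hC⟩ := hg.continuous.bounded_above_of_compact_support hgc
        exact hint.bdd_smul C hg.continuous.aestronglyMeasurable (.of_forall hC)
      rw [inner_zero_right, ← integral_inner hgf]
      refine Eq.trans ?_ h1
      simp only [ContinuousMap.coe_mk, inner_smul_left, inner_smul_right, RCLike.conj_to_real]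
  refine Lp.ext ?_
  filter_upwards [h0, ae_restrict_mem measurableSet_Ioo, Lp.coeFn_zero (EuclideanSpace ℝ (Fin n)) 2
    (volume.restrict (Ioo (0 : ℝ) 1))] with x h1 h2 h3
  rw [h1 h2, h3]; rfl

/-- Multiplication by a continuous matrix-valued function on `L²((0,1); ℝⁿ)`. -/
def mulL2 (N : C(ℝ, EuclideanSpace ℝ (Fin n) →L[ℝ] EuclideanSpace ℝ (Fin n))) :
    L2 n →L[ℝ] L2 n :=
  ContinuousLinearMap.holderL (volume.restrict (Ioo (0 : ℝ) 1)) ⊤ 2 2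
    (ContinuousLinearMap.id ℝ _) ((memLp_of_continuous N.continuous ⊤).toLp N)

theorem coeFn_mulL2 (N : C(ℝ, EuclideanSpace ℝ (Fin n) →L[ℝ] EuclideanSpace ℝ (Fin n)))
    (f : L2 n) : mulL2 N f =ᵐ[volume.restrict (Ioo (0 : ℝ) 1)] fun x => N x (f x) := by
  have h := ContinuousLinearMap.coeFn_holder (r := 2) (ContinuousLinearMap.id ℝ _)
    ((memLp_of_continuous N.continuous ⊤).toLp N) f
  filter_upwards [h, (memLp_of_continuous N.continuous ⊤).coeFn_toLp] with x h1 h2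
  rw [h2] at h1
  exact h1

theorem mulL2_toL2 (N : C(ℝ, EuclideanSpace ℝ (Fin n) →L[ℝ] EuclideanSpace ℝ (Fin n)))
    (f : C(ℝ, EuclideanSpace ℝ (Fin n))) :
    mulL2 N (toL2 f) = toL2 ⟨fun x => N x (f x), N.continuous.clm_apply f.continuous⟩ := by
  refine Lp.ext ?_
  filter_upwards [coeFn_mulL2 N (toL2 f), coeFn_toL2 f,
    coeFn_toL2 ⟨fun x => N x (f x), N.continuous.clm_apply f.continuous⟩] with x h1 h2 h3
  rw [h1, h2, h3]; rfl

theorem mulL2_mulL2_cancel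
    {N N' : C(ℝ, EuclideanSpace ℝ (Fin n) →L[ℝ] EuclideanSpace ℝ (Fin n))}
    (h : ∀ x e, N x (N' x e) = e) (f : L2 n) : mulL2 N (mulL2 N' f) = f := by
  refine Lp.ext ?_
  filter_upwards [coeFn_mulL2 N (mulL2 N' f), coeFn_mulL2 N' f] with x h1 h2
  rw [h1, h2, h]

end SwitchedHyperbolic

/-! ### Characteristic variables and the two boundary conditions. -/

namespace SwitchedHyperbolic
namespace Mode

variable {n : ℕ} (P : Mode n)

/-- The direction of propagation of the `k`-th characteristic variable. -/
def sgn (k : Fin n) : ℝ := if (k : ℕ) < P.m then -1 else 1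

/-- The end of `[0,1]` at which the `k`-th characteristic variable leaves. -/
def out (k : Fin n) : ℝ := if (k : ℕ) < P.m then 0 else 1

/-- The modulus of the `k`-th characteristic speed. -/
def speed (k : Fin n) : ℝ := P.sgn k * P.lam k

theorem speed_pos (k : Fin n) : 0 < P.speed k := by
  unfold speed sgn
  split_ifs with h
  · linarith [P.lam_neg k h]
  · linarith [P.lam_pos k (not_lt.1 h)]

theorem sgn_mul_sgn (k : Fin n) : P.sgn k * P.sgn k = 1 := by
  unfold sgn; split_ifs <;> norm_num

theorem lam_eq (k : Fin n) : P.lam k = P.sgn k * P.speed k := by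
  rw [speed, ← mul_assoc, sgn_mul_sgn, one_mul]

theorem lam_ne_zero (k : Fin n) : P.lam k ≠ 0 := fun h => by
  have := P.speed_pos k
  simp [speed, h] at this

theorem isUnit_det_S : IsUnit P.S.det := (Matrix.isUnit_iff_isUnit_det _).1 P.S_isUnit

theorem S_mulVec_cancel (z : Fin n → ℝ) : P.S.mulVec (P.S⁻¹.mulVec z) = z := by
  rw [Matrix.mulVec_mulVec, Matrix.mul_nonsing_inv _ P.isUnit_det_S, Matrix.one_mulVec]

/-- The coefficients of the vector `p` dual to the characteristic variables. -/
def dual (p : EuclideanSpace ℝ (Fin n)) : Fin n → ℝ := P.S⁻¹.transpose.mulVec p.ofLp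

theorem inner_L (p u : EuclideanSpace ℝ (Fin n)) :
    inner ℝ p (P.L.toEuclideanLin u) = ∑ k, P.dual p k * (P.lam k * P.S.mulVec u.ofLp k) := by
  have h1 : inner ℝ p (P.L.toEuclideanLin u) = p.ofLp ⬝ᵥ P.L.mulVec u.ofLp := by
    rw [EuclideanSpace.inner_eq_star_dotProduct, dotProduct_comm]; rfl
  rw [h1, L, ← Matrix.mulVec_mulVec, ← Matrix.mulVec_mulVec, Matrix.dotProduct_mulVec,
    ← Matrix.mulVec_transpose]
  simp only [dotProduct, Matrix.mulVec_diagonal]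
  rfl

theorem boundaryCondition_iff (u₀ u₁ : EuclideanSpace ℝ (Fin n)) :
    P.BoundaryCondition u₀ u₁ ↔ ∀ j : Fin n,
      (if (j : ℕ) < P.m then P.S.mulVec u₁.ofLp j else P.S.mulVec u₀.ofLp j)
        = ∑ k, P.G j k * (if (k : ℕ) < P.m then P.S.mulVec u₀.ofLp k else P.S.mulVec u₁.ofLp k) := by
  have h0 : P.BoundaryCondition u₀ u₁ ↔
      P.G0.mulVec (P.S.mulVec u₀.ofLp) + P.G1.mulVec (P.S.mulVec u₁.ofLp) = 0 := by
    rw [BoundaryCondition, B0, B1, Matrix.mulVec_mulVec, Matrix.mulVec_mulVec]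
    exact (WithLp.ofLp_injective 2).eq_iff.symm
  rw [h0, funext_iff]
  refine forall_congr' fun j => ?_
  rw [← sub_eq_zero (a := ite _ _ _)]
  refine Eq.congr ?_ rfl
  have : (if (j : ℕ) < P.m then P.S.mulVec u₁.ofLp j else P.S.mulVec u₀.ofLp j) =
      ∑ k, (1 : Matrix (Fin n) (Fin n) ℝ) j k *
        (if (k : ℕ) < P.m then P.S.mulVec u₁.ofLp k else P.S.mulVec u₀.ofLp k) := by
    simp only [Matrix.one_apply, ite_mul, one_mul, zero_mul, Finset.sum_ite_eq, Finset.mem_univ,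
      if_true]
  rw [this, ← Finset.sum_sub_distrib, Pi.add_apply, Matrix.mulVec, Matrix.mulVec, dotProduct,
    dotProduct, ← Finset.sum_add_distrib]
  refine Finset.sum_congr rfl fun k _ => ?_
  simp only [G0, G1, Matrix.of_apply]
  split_ifs <;> ring

/-- In dual characteristic variables, the adjoint boundary condition expresses the outgoing
components by the incoming ones. -/
theorem adjointBoundaryCondition_iff (p₀ p₁ : EuclideanSpace ℝ (Fin n)) :
    P.AdjointBoundaryCondition p₀ p₁ ↔ ∀ k,
      P.speed k * (if (k : ℕ) < P.m then P.dual p₀ k else P.dual p₁ k)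
        = ∑ j, P.G j k * (P.speed j * (if (j : ℕ) < P.m then P.dual p₁ j else P.dual p₀ j)) := by
  -- Once the incoming components of `u` are eliminated by the boundary condition, the boundary form
  -- is linear in the free outgoing components; its coefficients are the defects of the adjoint
  -- relation.
  have key : ∀ u₀ u₁ : EuclideanSpace ℝ (Fin n), P.BoundaryCondition u₀ u₁ →
      inner ℝ p₁ (P.L.toEuclideanLin u₁) - inner ℝ p₀ (P.L.toEuclideanLin u₀) =
      ∑ k, (P.speed k * (if (k : ℕ) < P.m then P.dual p₀ k else P.dual p₁ k)
        - ∑ j, P.G j k * (P.speed j * (if (j : ℕ) < P.m then P.dual p₁ j else P.dual p₀ j))) *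
        (if (k : ℕ) < P.m then P.S.mulVec u₀.ofLp k else P.S.mulVec u₁.ofLp k) := by
    intro u₀ u₁ hu
    rw [boundaryCondition_iff] at hu
    set zo : Fin n → ℝ := fun k =>
      if (k : ℕ) < P.m then P.S.mulVec u₀.ofLp k else P.S.mulVec u₁.ofLp k with hzo
    simp only [sub_mul, Finset.sum_sub_distrib, Finset.sum_mul]
    rw [Finset.sum_comm, inner_L, inner_L, ← Finset.sum_sub_distrib, ← Finset.sum_sub_distrib]
    refine Finset.sum_congr rfl fun k _ => ?_
    have h1 : ∑ j, P.G k j * (P.speed k * (if (k : ℕ) < P.m then P.dual p₁ k else P.dual p₀ k)) *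
        zo j = (P.speed k * (if (k : ℕ) < P.m then P.dual p₁ k else P.dual p₀ k)) *
        (if (k : ℕ) < P.m then P.S.mulVec u₁.ofLp k else P.S.mulVec u₀.ofLp k) := by
      rw [hu k, Finset.mul_sum]
      exact Finset.sum_congr rfl fun j _ => by ring
    simp only [hzo] at h1 ⊢
    rw [h1, speed, sgn]
    split_ifs <;> ring
  constructor
  · intro h k
    -- Outgoing data a unit vector, incoming data the matching column of `G`: this isolates the
    -- `k`-th coefficient.
    set zi : Fin n → ℝ := fun j => P.G j k with hzi
    set zo : Fin n → ℝ := Pi.single k 1 with hzo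
    set u₀ : EuclideanSpace ℝ (Fin n) :=
      WithLp.toLp 2 (P.S⁻¹.mulVec fun j => if (j : ℕ) < P.m then zo j else zi j)
    set u₁ : EuclideanSpace ℝ (Fin n) :=
      WithLp.toLp 2 (P.S⁻¹.mulVec fun j => if (j : ℕ) < P.m then zi j else zo j)
    have e0 : P.S.mulVec u₀.ofLp = _ := P.S_mulVec_cancel _
    have e1 : P.S.mulVec u₁.ofLp = _ := P.S_mulVec_cancel _
    have eo : ∀ j : Fin n, (if (j : ℕ) < P.m then P.S.mulVec u₀.ofLp j
        else P.S.mulVec u₁.ofLp j) = zo j := by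
      intro j; rw [e0, e1]; beta_reduce; split_ifs <;> rfl
    have hbc : P.BoundaryCondition u₀ u₁ := by
      rw [boundaryCondition_iff]
      intro j
      simp only [eo]
      rw [e0, e1]
      simp only [hzo, hzi, Pi.single_apply, mul_ite, mul_one, mul_zero, Finset.sum_ite_eq',
        Finset.mem_univ, if_true]
      split_ifs <;> rfl
    have h1 := key u₀ u₁ hbc
    rw [h u₀ u₁ hbc, sub_self] at h1
    simp only [eo] at h1
    rw [Finset.sum_eq_single k (fun j _ hj => by rw [hzo, Pi.single_eq_of_ne hj, mul_zero])
      (fun hk => absurd (Finset.mem_univ k) hk), hzo, Pi.single_eq_same, mul_one] at h1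
    exact sub_eq_zero.1 h1.symm
  · intro h u₀ u₁ hu
    have h1 := key u₀ u₁ hu
    simp only [h, sub_self, zero_mul, Finset.sum_const_zero] at h1
    linarith

/-- The outgoing dual variables are controlled by the incoming ones. -/
theorem exists_exp_bound : ∃ κ : ℝ, 0 ≤ κ ∧ ∀ zi zo : Fin n → ℝ,
    (∀ k, P.speed k * zo k = ∑ j, P.G j k * (P.speed j * zi j)) →
      ∑ k, P.speed k * zo k ^ 2 ≤ Real.exp κ ^ 2 * ∑ k, P.speed k * zi k ^ 2 := by
  set C : ℝ := ∑ k, (P.speed k)⁻¹ * ∑ j, P.G j k ^ 2 * P.speed j with hC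
  have hs := P.speed_pos
  have hC0 : 0 ≤ C := Finset.sum_nonneg fun k _ => mul_nonneg (inv_nonneg.2 (hs k).le)
    (Finset.sum_nonneg fun j _ => mul_nonneg (sq_nonneg _) (hs j).le)
  -- Cauchy–Schwarz gives the constant `C`, and `C ≤ (exp C)²`, so `κ = C` will do.
  refine ⟨C, hC0, fun zi zo h => ?_⟩
  have hE0 : 0 ≤ ∑ k, P.speed k * zi k ^ 2 :=
    Finset.sum_nonneg fun k _ => mul_nonneg (hs k).le (sq_nonneg _)
  have h1 : ∀ k, P.speed k * zo k ^ 2 ≤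
      ((P.speed k)⁻¹ * ∑ j, P.G j k ^ 2 * P.speed j) * ∑ j, P.speed j * zi j ^ 2 := by
    intro k
    have hcs := Finset.sum_mul_sq_le_sq_mul_sq Finset.univ
      (fun j => P.G j k * Real.sqrt (P.speed j)) (fun j => Real.sqrt (P.speed j) * zi j)
    have e1 : ∑ j, P.G j k * Real.sqrt (P.speed j) * (Real.sqrt (P.speed j) * zi j)
        = P.speed k * zo k := by
      rw [h]
      refine Finset.sum_congr rfl fun j _ => ?_
      have := Real.mul_self_sqrt (hs j).le
      linear_combination P.G j k * zi j * this
    simp only [e1, mul_pow, Real.sq_sqrt (hs _).le] at hcs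
    rw [mul_assoc, inv_mul_eq_div, le_div_iff₀ (hs k)]
    linarith
  calc ∑ k, P.speed k * zo k ^ 2 ≤ C * ∑ k, P.speed k * zi k ^ 2 := by
        rw [hC, Finset.sum_mul]; exact Finset.sum_le_sum fun k _ => h1 k
    _ ≤ _ := by
        gcongr
        have := Real.add_one_le_exp C
        nlinarith

end Mode
end SwitchedHyperbolic

/-! ### Exponential weights and the energy estimate. -/

namespace SwitchedHyperbolic
namespace Mode

variable {n : ℕ} (P : Mode n)

/-- Exponential weights that grow from the outflow end of `[0,1]` to the inflow end. -/
def weight (κ : ℝ) (k : Fin n) (x : ℝ) : ℝ := Real.exp (κ * (P.sgn k * (P.out k - x)))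

theorem continuous_weight (κ : ℝ) (k : Fin n) : Continuous (P.weight κ k) := by
  unfold weight; fun_prop

theorem weight_neg_mul (κ : ℝ) (k : Fin n) (x : ℝ) : P.weight (-κ) k x * P.weight κ k x = 1 := by
  rw [weight, weight, ← Real.exp_add, neg_mul, neg_add_cancel, Real.exp_zero]

theorem weight_out (κ : ℝ) (k : Fin n) : P.weight κ k (P.out k) = 1 := by
  simp [weight]

theorem weight_in (κ : ℝ) (k : Fin n) : P.weight κ k (1 - P.out k) = Real.exp κ := by
  unfold weight sgn out; split_ifs <;> norm_num

theorem hasDerivAt_weight (κ : ℝ) (k : Fin n) (x : ℝ) :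
    HasDerivAt (P.weight κ k) (-(κ * P.sgn k) * P.weight κ k x) x := by
  have h1 : HasDerivAt (fun x => κ * (P.sgn k * (P.out k - x))) (κ * (P.sgn k * -1)) x :=
    (((hasDerivAt_id x).const_sub _).const_mul _).const_mul _
  exact HasDerivAt.congr_deriv h1.exp (by unfold weight; ring)

theorem continuous_toEuclideanCLM {N : ℝ → Matrix (Fin n) (Fin n) ℝ} (hN : Continuous N) :
    Continuous fun x => Matrix.toEuclideanCLM (𝕜 := ℝ) (N x) :=
  (LinearMap.continuous_of_finiteDimensional
    (Matrix.toEuclideanCLM (n := Fin n) (𝕜 := ℝ)).toAlgEquiv.toLinearMap).comp hN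

/-- The passage to weighted dual characteristic variables. -/
def toChar (κ : ℝ) : C(ℝ, EuclideanSpace ℝ (Fin n) →L[ℝ] EuclideanSpace ℝ (Fin n)) where
  toFun x := Matrix.toEuclideanCLM (𝕜 := ℝ)
    (Matrix.diagonal (fun k => P.weight κ k x) * P.S⁻¹.transpose)
  continuous_toFun := continuous_toEuclideanCLM
    (((continuous_pi fun k => P.continuous_weight κ k).matrix_diagonal).matrix_mul
      continuous_const)

/-- The passage back from weighted dual characteristic variables. -/
def ofChar (κ : ℝ) : C(ℝ, EuclideanSpace ℝ (Fin n) →L[ℝ] EuclideanSpace ℝ (Fin n)) where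
  toFun x := Matrix.toEuclideanCLM (𝕜 := ℝ)
    (P.S.transpose * Matrix.diagonal (fun k => P.weight (-κ) k x))
  continuous_toFun := continuous_toEuclideanCLM
    (continuous_const.matrix_mul
      ((continuous_pi fun k => P.continuous_weight (-κ) k).matrix_diagonal))

theorem toChar_apply (κ x : ℝ) (p : EuclideanSpace ℝ (Fin n)) (k : Fin n) :
    P.toChar κ x p k = P.weight κ k x * P.dual p k := by
  rw [dual, ← Matrix.mulVec_diagonal (fun k => P.weight κ k x), Matrix.mulVec_mulVec]
  rfl

theorem S_transpose_mul : P.S.transpose * P.S⁻¹.transpose = 1 := by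
  rw [← Matrix.transpose_mul, Matrix.nonsing_inv_mul _ P.isUnit_det_S, Matrix.transpose_one]

theorem transpose_S_mul : P.S⁻¹.transpose * P.S.transpose = 1 := by
  rw [← Matrix.transpose_mul, Matrix.mul_nonsing_inv _ P.isUnit_det_S, Matrix.transpose_one]

theorem diagonal_weight_mul (κ x : ℝ) :
    Matrix.diagonal (fun k => P.weight (-κ) k x) * Matrix.diagonal (fun k => P.weight κ k x) = 1 := by
  simp only [Matrix.diagonal_mul_diagonal, weight_neg_mul, Matrix.diagonal_one]

theorem ofChar_toChar (κ x : ℝ) (p : EuclideanSpace ℝ (Fin n)) :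
    P.ofChar κ x (P.toChar κ x p) = p := by
  refine WithLp.ofLp_injective 2 ?_
  change (P.S.transpose * Matrix.diagonal fun k => P.weight (-κ) k x).mulVec
    ((Matrix.diagonal (fun k => P.weight κ k x) * P.S⁻¹.transpose).mulVec p.ofLp) = p.ofLp
  rw [Matrix.mulVec_mulVec, Matrix.mul_assoc, ← Matrix.mul_assoc (Matrix.diagonal _),
    diagonal_weight_mul, Matrix.one_mul, S_transpose_mul, Matrix.one_mulVec]

theorem toChar_ofChar (κ x : ℝ) (p : EuclideanSpace ℝ (Fin n)) :
    P.toChar κ x (P.ofChar κ x p) = p := by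
  have h := P.diagonal_weight_mul (-κ) x
  rw [neg_neg] at h
  refine WithLp.ofLp_injective 2 ?_
  change (Matrix.diagonal (fun k => P.weight κ k x) * P.S⁻¹.transpose).mulVec
    ((P.S.transpose * Matrix.diagonal fun k => P.weight (-κ) k x).mulVec p.ofLp) = p.ofLp
  rw [Matrix.mulVec_mulVec, Matrix.mul_assoc, ← Matrix.mul_assoc P.S⁻¹.transpose, transpose_S_mul,
    Matrix.one_mul, h, Matrix.one_mulVec]

theorem dual_L_transpose (p : EuclideanSpace ℝ (Fin n)) (k : Fin n) :
    P.dual (P.L.transpose.toEuclideanLin p) k = P.lam k * P.dual p k := by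
  have : P.S⁻¹.transpose * P.L.transpose = Matrix.diagonal P.lam * P.S⁻¹.transpose := by
    rw [L, ← Matrix.transpose_mul, ← Matrix.diagonal_transpose, ← Matrix.transpose_mul,
      Matrix.mul_assoc, Matrix.mul_nonsing_inv _ P.isUnit_det_S, Matrix.mul_one,
      Matrix.diagonal_transpose]
  rw [dual, dual, ← Matrix.mulVec_diagonal, Matrix.mulVec_mulVec, ← this, ← Matrix.mulVec_mulVec]
  rfl

/-- A dual variable as a continuous linear functional. -/
def dualCLM (k : Fin n) : EuclideanSpace ℝ (Fin n) →L[ℝ] ℝ :=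
  EuclideanSpace.proj k ∘L Matrix.toEuclideanCLM (𝕜 := ℝ) P.S⁻¹.transpose

theorem dual_smul (c : ℝ) (p : EuclideanSpace ℝ (Fin n)) (k : Fin n) :
    P.dual (c • p) k = c * P.dual p k := (P.dualCLM k).map_smul c p

theorem dual_toLp_mulVec (z : Fin n → ℝ) :
    P.dual (WithLp.toLp 2 (P.S.transpose.mulVec z)) = z := by
  rw [dual, Matrix.mulVec_mulVec, transpose_S_mul, Matrix.one_mulVec]

theorem dual_injective : Function.Injective P.dual := by
  intro p q h
  have := congrArg (P.S.transpose.mulVec) h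
  rw [dual, dual, Matrix.mulVec_mulVec, Matrix.mulVec_mulVec, S_transpose_mul, Matrix.one_mulVec,
    Matrix.one_mulVec] at this
  exact WithLp.ofLp_injective 2 this

theorem adjointBoundaryCondition_iff_dual (η : ℝ → EuclideanSpace ℝ (Fin n)) :
    P.AdjointBoundaryCondition (η 0) (η 1) ↔ ∀ k,
      P.speed k * P.dual (η (P.out k)) k
        = ∑ j, P.G j k * (P.speed j * P.dual (η (1 - P.out j)) j) := by
  rw [adjointBoundaryCondition_iff]
  have h1 : ∀ k : Fin n, (if (k : ℕ) < P.m then P.dual (η 0) k else P.dual (η 1) k)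
      = P.dual (η (P.out k)) k := by
    intro k; unfold out; split_ifs <;> rfl
  have h2 : ∀ k : Fin n, (if (k : ℕ) < P.m then P.dual (η 1) k else P.dual (η 0) k)
      = P.dual (η (1 - P.out k)) k := by
    intro k; unfold out; split_ifs <;> norm_num
  simp only [h1, h2]

/-- The stationary test functions. -/
def testSpace : Submodule ℝ (ℝ → EuclideanSpace ℝ (Fin n)) where
  carrier := {η | ContDiff ℝ 1 η ∧ P.AdjointBoundaryCondition (η 0) (η 1)}
  add_mem' := by
    rintro η θ ⟨h1, h2⟩ ⟨h3, h4⟩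
    refine ⟨h1.add h3, fun u₀ u₁ hu => ?_⟩
    simp only [Pi.add_apply, inner_add_left, h2 u₀ u₁ hu, h4 u₀ u₁ hu]
  zero_mem' := ⟨contDiff_const, fun u₀ u₁ hu => by simp⟩
  smul_mem' := by
    rintro c η ⟨h1, h2⟩
    refine ⟨contDiff_const.smul h1, fun u₀ u₁ hu => ?_⟩
    simp only [Pi.smul_apply, inner_smul_left, h2 u₀ u₁ hu]

/-- A test function as a continuous function. -/
def testFun : P.testSpace →ₗ[ℝ] C(ℝ, EuclideanSpace ℝ (Fin n)) where
  toFun η := ⟨η, η.2.1.continuous⟩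
  map_add' _ _ := rfl
  map_smul' _ _ := rfl

/-- The derivative of a test function. -/
def testDeriv : P.testSpace →ₗ[ℝ] C(ℝ, EuclideanSpace ℝ (Fin n)) where
  toFun η := ⟨deriv η, η.2.1.continuous_deriv le_rfl⟩
  map_add' η θ := by
    ext1 x
    exact deriv_add (η.2.1.differentiable one_ne_zero x) (θ.2.1.differentiable one_ne_zero x)
  map_smul' c η := by
    ext1 x
    exact deriv_const_smul c (η.2.1.differentiable one_ne_zero x)

/-- Multiplication of continuous functions by a constant matrix. -/
def matMap (A : Matrix (Fin n) (Fin n) ℝ) :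
    C(ℝ, EuclideanSpace ℝ (Fin n)) →ₗ[ℝ] C(ℝ, EuclideanSpace ℝ (Fin n)) where
  toFun f := ⟨fun x => Matrix.toEuclideanCLM (𝕜 := ℝ) A (f x), by fun_prop⟩
  map_add' f g := by ext1 x; exact map_add (Matrix.toEuclideanCLM (𝕜 := ℝ) A) (f x) (g x)
  map_smul' c f := by ext1 x; exact map_smul (Matrix.toEuclideanCLM (𝕜 := ℝ) A) c (f x)

theorem hasDerivAt_dual (η : P.testSpace) (k : Fin n) (x : ℝ) :
    HasDerivAt (fun x => P.dual (η.1 x) k) (P.dual (deriv η.1 x) k) x :=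
  (P.dualCLM k).hasFDerivAt.comp_hasDerivAt x (η.2.1.differentiable one_ne_zero x).hasDerivAt

theorem continuous_dual_comp {η : ℝ → EuclideanSpace ℝ (Fin n)} (hη : Continuous η) (k : Fin n) :
    Continuous fun x => P.dual (η x) k := (P.dualCLM k).continuous.comp hη

/-- The weighted energy estimate for the adjoint transport operator. -/
theorem dissipative_transport {κ : ℝ} (hκ : 0 ≤ κ)
    (hb : ∀ zi zo : Fin n → ℝ, (∀ k, P.speed k * zo k = ∑ j, P.G j k * (P.speed j * zi j)) →
      ∑ k, P.speed k * zo k ^ 2 ≤ Real.exp κ ^ 2 * ∑ k, P.speed k * zi k ^ 2)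
    (η : P.testSpace) :
    inner ℝ (mulL2 (P.toChar κ) (toL2 (P.testFun η)))
        (mulL2 (P.toChar κ) (toL2 (matMap P.L.transpose (P.testDeriv η))))
      ≤ (κ * ∑ k, P.speed k) * ‖mulL2 (P.toChar κ) (toL2 (P.testFun η))‖ ^ 2 := by
  set ζ : Fin n → ℝ → ℝ := fun k x => P.dual (η.1 x) k with hζ
  set ζ' : Fin n → ℝ → ℝ := fun k x => P.dual (deriv η.1 x) k with hζ'
  have hd : ∀ k x, HasDerivAt (ζ k) (ζ' k x) x := P.hasDerivAt_dual η
  have hζc : ∀ k, Continuous (ζ k) := P.continuous_dual_comp η.2.1.continuous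
  have hζ'c : ∀ k, Continuous (ζ' k) := P.continuous_dual_comp (η.2.1.continuous_deriv le_rfl)
  have hwc := P.continuous_weight κ
  -- The weighted energy flux. Its derivative is the integrand to be estimated, minus the terms `κ
  -- |λₖ|` times the weighted squares that come from differentiating the weights.
  set F : ℝ → ℝ := fun x => ∑ k, P.lam k / 2 * (P.weight κ k x ^ 2 * ζ k x ^ 2) with hF
  set F' : ℝ → ℝ := fun x => ∑ k, (P.weight κ k x * ζ k x * (P.weight κ k x * (P.lam k * ζ' k x))
    - κ * P.speed k * (P.weight κ k x * ζ k x) ^ 2) with hF'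
  have hFd : ∀ x, HasDerivAt F (F' x) x := by
    intro x
    refine HasDerivAt.fun_sum fun k _ => ?_
    have h := (((P.hasDerivAt_weight κ k x).pow 2).mul ((hd k x).pow 2)).const_mul (P.lam k / 2)
    refine HasDerivAt.congr_deriv h ?_
    simp only [speed, Pi.pow_apply]
    ring
  have hF'c : Continuous F' := by
    rw [hF']; fun_prop
  have hI := intervalIntegral.integral_eq_sub_of_hasDerivAt (fun x _ => hFd x)
    (hF'c.intervalIntegrable 0 1)
  -- The weights are `1` at the outflow ends and `exp κ` at the inflow ends, which is the comparison
  -- in `hb`.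
  have hbd : F 1 - F 0 ≤ 0 := by
    have h1 := hb _ _ ((P.adjointBoundaryCondition_iff_dual η.1).1 η.2.2)
    have h2 : F 1 - F 0 = (∑ k, P.speed k * ζ k (P.out k) ^ 2
        - Real.exp κ ^ 2 * ∑ k, P.speed k * ζ k (1 - P.out k) ^ 2) / 2 := by
      rw [hF, ← Finset.sum_sub_distrib, Finset.mul_sum, ← Finset.sum_sub_distrib, Finset.sum_div]
      refine Finset.sum_congr rfl fun k _ => ?_
      have e1 := P.weight_out κ k
      have e2 := P.weight_in κ k
      rw [P.lam_eq]
      unfold out at e1 e2 ⊢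
      unfold sgn
      split_ifs at e1 e2 ⊢
      · norm_num at e1 e2 ⊢; rw [e1, e2]; ring
      · norm_num at e1 e2 ⊢; rw [e1, e2]; ring
    rw [h2]
    linarith
  rw [mulL2_toL2, mulL2_toL2, ← real_inner_self_eq_norm_sq, inner_toL2_toL2, inner_toL2_toL2,
    ← intervalIntegral.integral_const_mul]
  simp only [ContinuousMap.coe_mk, PiLp.inner_apply, toChar_apply]
  have hp : ∀ x, ∑ k, inner ℝ (P.weight κ k x * P.dual (P.testFun η x) k)
      (P.weight κ k x * P.dual (matMap P.L.transpose (P.testDeriv η) x) k)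
      ≤ F' x + (κ * ∑ k, P.speed k) * ∑ k, inner ℝ (P.weight κ k x * P.dual (P.testFun η x) k)
        (P.weight κ k x * P.dual (P.testFun η x) k) := by
    intro x
    rw [hF', Finset.mul_sum, ← Finset.sum_add_distrib]
    refine Finset.sum_le_sum fun k _ => ?_
    have e1 : P.dual (matMap P.L.transpose (P.testDeriv η) x) k = P.lam k * ζ' k x :=
      P.dual_L_transpose _ k
    have e2 : P.dual (P.testFun η x) k = ζ k x := rfl
    have hs : P.speed k ≤ ∑ k, P.speed k :=
      Finset.single_le_sum (fun k _ => (P.speed_pos k).le) (Finset.mem_univ k)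
    rw [e1, e2]
    simp only [RCLike.inner_apply, RCLike.conj_to_real]
    have := mul_le_mul_of_nonneg_right (mul_le_mul_of_nonneg_left hs hκ)
      (sq_nonneg (P.weight κ k x * ζ k x))
    nlinarith
  have hc1 : Continuous fun x => ∑ k, inner ℝ (P.weight κ k x * P.dual (P.testFun η x) k)
      (P.weight κ k x * P.dual (matMap P.L.transpose (P.testDeriv η) x) k) :=
    continuous_finsetSum _ fun k _ => ((hwc k).mul (P.continuous_dual_comp
      (P.testFun η).continuous k)).inner ((hwc k).mul (P.continuous_dual_comp
        (matMap P.L.transpose (P.testDeriv η)).continuous k))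
  have hc2 : Continuous fun x => (κ * ∑ k, P.speed k) *
      ∑ k, inner ℝ (P.weight κ k x * P.dual (P.testFun η x) k)
      (P.weight κ k x * P.dual (P.testFun η x) k) :=
    continuous_const.mul (continuous_finsetSum _ fun k _ => ((hwc k).mul (P.continuous_dual_comp
      (P.testFun η).continuous k)).inner ((hwc k).mul (P.continuous_dual_comp
        (P.testFun η).continuous k)))
  refine (intervalIntegral.integral_mono_on zero_le_one (hc1.intervalIntegrable 0 1)
    ((hF'c.add hc2).intervalIntegrable 0 1) fun x _ => hp x).trans ?_
  simp only [Pi.add_apply]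
  rw [intervalIntegral.integral_add (hF'c.intervalIntegrable 0 1) (hc2.intervalIntegrable 0 1),
    hI]
  linarith

end Mode
end SwitchedHyperbolic

/-! ### The resolvent equation and the unswitched problem. -/

namespace SwitchedHyperbolic
namespace Mode

variable {n : ℕ} (P : Mode n)

/-- The solution `y` of `l y - μ y' = g` with `y o = h`. -/
def odeSol (l μ o h : ℝ) (g : ℝ → ℝ) (x : ℝ) : ℝ :=
  Real.exp (l / μ * (x - o)) * (h - ∫ s in o..x, Real.exp (-(l / μ * (s - o))) * (g s / μ))

theorem hasDerivAt_odeSol (l μ o h : ℝ) {g : ℝ → ℝ} (hg : Continuous g) (x : ℝ) :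
    HasDerivAt (odeSol l μ o h g) (l / μ * odeSol l μ o h g x - g x / μ) x := by
  have h1 : HasDerivAt (fun x => Real.exp (l / μ * (x - o)))
      (Real.exp (l / μ * (x - o)) * (l / μ * 1)) x :=
    (((hasDerivAt_id x).sub_const o).const_mul _).exp
  have hc : Continuous fun s => Real.exp (-(l / μ * (s - o))) * (g s / μ) := by fun_prop
  have h2 : HasDerivAt (fun x => h - ∫ s in o..x, Real.exp (-(l / μ * (s - o))) * (g s / μ))
      (-(Real.exp (-(l / μ * (x - o))) * (g x / μ))) x :=
    (intervalIntegral.integral_hasDerivAt_right (hc.intervalIntegrable _ _)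
      (hc.stronglyMeasurableAtFilter _ _) hc.continuousAt).const_sub h
  refine HasDerivAt.congr_deriv (h1.mul h2) ?_
  have h3 : Real.exp (l / μ * (x - o)) * Real.exp (-(l / μ * (x - o))) = 1 := by
    rw [← Real.exp_add, add_neg_cancel, Real.exp_zero]
  unfold odeSol
  linear_combination (-(g x / μ)) * h3

theorem contDiff_odeSol (l μ o h : ℝ) {g : ℝ → ℝ} (hg : Continuous g) :
    ContDiff ℝ 1 (odeSol l μ o h g) := by
  have hd := hasDerivAt_odeSol l μ o h hg
  have hdiff : Differentiable ℝ (odeSol l μ o h g) := fun x => (hd x).differentiableAt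
  refine contDiff_one_iff_deriv.2 ⟨hdiff, ?_⟩
  rw [funext fun x => (hd x).deriv]
  have := hdiff.continuous
  fun_prop

/-- The boundary values in the resolvent equation for the adjoint operator can be prescribed. -/
theorem exists_boundary_values {κ : ℝ}
    (hb : ∀ zi zo : Fin n → ℝ, (∀ k, P.speed k * zo k = ∑ j, P.G j k * (P.speed j * zi j)) →
      ∑ k, P.speed k * zo k ^ 2 ≤ Real.exp κ ^ 2 * ∑ k, P.speed k * zi k ^ 2)
    (e b : Fin n → ℝ) (he : ∀ k, 0 < e k) (heκ : ∀ k, Real.exp κ * e k < 1) :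
    ∃ h : Fin n → ℝ, ∀ k, P.speed k * h k = ∑ j, P.G j k * (P.speed j * (e j * (h j - b j))) := by
  set T : Matrix (Fin n) (Fin n) ℝ := Matrix.diagonal P.speed
    - P.G.transpose * Matrix.diagonal (fun j => P.speed j * e j) with hT
  have hTa : ∀ h k, T.mulVec h k
      = P.speed k * h k - ∑ j, P.G j k * (P.speed j * (e j * h j)) := by
    intro h k
    have hG : ∀ z, P.G.transpose.mulVec z k = ∑ j, P.G j k * z j := fun z => rfl
    rw [hT, Matrix.sub_mulVec, ← Matrix.mulVec_mulVec, Pi.sub_apply, Matrix.mulVec_diagonal, hG]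
    refine congrArg _ (Finset.sum_congr rfl fun j _ => ?_)
    rw [Matrix.mulVec_diagonal, mul_assoc (P.speed j)]
  -- For a homogeneous solution, `hb` bounds the energy of `h` by that of `exp κ · e h`, which is
  -- strictly smaller unless `h = 0`. Injectivity of a square matrix gives solvability.
  have hinj : Function.Injective T.mulVecLin := by
    refine (injective_iff_map_eq_zero _).2 fun h hh => ?_
    have h0 : ∀ k, P.speed k * h k = ∑ j, P.G j k * (P.speed j * (e j * h j)) := fun k => by
      have := congrFun hh k
      rw [Matrix.mulVecLin_apply, hTa] at this
      simpa [sub_eq_zero] using this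
    have h1 := hb (fun j => e j * h j) h h0
    rw [Finset.mul_sum, ← sub_nonpos, ← Finset.sum_sub_distrib] at h1
    have h2 : ∀ k, P.speed k * h k ^ 2 - Real.exp κ ^ 2 * (P.speed k * (e k * h k) ^ 2)
        = P.speed k * (1 - (Real.exp κ * e k) ^ 2) * h k ^ 2 := fun k => by ring
    simp only [h2] at h1
    have h3 : ∀ k, 0 < P.speed k * (1 - (Real.exp κ * e k) ^ 2) := fun k => by
      have := mul_pos (Real.exp_pos κ) (he k)
      have := heκ k
      exact mul_pos (P.speed_pos k) (by nlinarith)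
    have h4 := (Finset.sum_eq_zero_iff_of_nonneg fun k _ =>
      mul_nonneg (h3 k).le (sq_nonneg (h k))).1
        (le_antisymm h1 (Finset.sum_nonneg fun k _ => mul_nonneg (h3 k).le (sq_nonneg _)))
    funext k
    have := h4 k (Finset.mem_univ k)
    rcases mul_eq_zero.1 this with h5 | h5
    · exact absurd h5 (h3 k).ne'
    · exact pow_eq_zero_iff two_ne_zero |>.1 h5
  obtain ⟨h, hh⟩ := Matrix.mulVec_surjective_iff_isUnit.2
    (Matrix.mulVec_injective_iff_isUnit.1 hinj)
    (fun k => -∑ j, P.G j k * (P.speed j * (e j * b j)))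
  refine ⟨h, fun k => ?_⟩
  have h1 := congrFun hh k
  rw [hTa] at h1
  simp only [mul_sub, Finset.sum_sub_distrib]
  linarith

/-- The resolvent equation of the adjoint transport operator. -/
theorem exists_test_eq {κ : ℝ} (hκ : 0 ≤ κ)
    (hb : ∀ zi zo : Fin n → ℝ, (∀ k, P.speed k * zo k = ∑ j, P.G j k * (P.speed j * zi j)) →
      ∑ k, P.speed k * zo k ^ 2 ≤ Real.exp κ ^ 2 * ∑ k, P.speed k * zi k ^ 2)
    {l : ℝ} (hl : κ * ∑ k, P.speed k < l) (ξ : C(ℝ, EuclideanSpace ℝ (Fin n))) :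
    ∃ η : P.testSpace, l • P.testFun η - matMap P.L.transpose (P.testDeriv η) = ξ := by
  have hξ := P.continuous_dual_comp ξ.continuous
  -- Starting from `h k` at the outflow end, variation of constants gives the value `e k * (h k - b
  -- k)` at the other end, with `e k = exp (-l / |λₖ|)`.
  set e : Fin n → ℝ := fun k => Real.exp (l / P.lam k * ((1 - P.out k) - P.out k)) with he
  set b : Fin n → ℝ := fun k => ∫ s in P.out k..(1 - P.out k),
    Real.exp (-(l / P.lam k * (s - P.out k))) * (P.dual (ξ s) k / P.lam k) with hbdef
  have heκ : ∀ k, Real.exp κ * e k < 1 := by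
    intro k
    have h1 : l / P.lam k * ((1 - P.out k) - P.out k) = -(l / P.speed k) := by
      rw [speed]; unfold sgn out
      split_ifs <;> norm_num [div_neg]
    have h2 : κ < l / P.speed k := by
      rw [lt_div_iff₀ (P.speed_pos k)]
      refine lt_of_le_of_lt (mul_le_mul_of_nonneg_left ?_ hκ) hl
      exact Finset.single_le_sum (fun k _ => (P.speed_pos k).le) (Finset.mem_univ k)
    rw [he, ← Real.exp_add, Real.exp_lt_one_iff, h1]
    linarith
  obtain ⟨h, hh⟩ := P.exists_boundary_values hb e b (fun k => Real.exp_pos _) heκ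
  set ζ : ℝ → Fin n → ℝ := fun x k =>
    odeSol l (P.lam k) (P.out k) (h k) (fun s => P.dual (ξ s) k) x with hζ
  set η : ℝ → EuclideanSpace ℝ (Fin n) := fun x => WithLp.toLp 2 (P.S.transpose.mulVec (ζ x))
    with hη
  have hdual : ∀ x, P.dual (η x) = ζ x := fun x => P.dual_toLp_mulVec _
  have hηc : ContDiff ℝ 1 η := by
    refine contDiff_euclidean.2 fun i => ?_
    change ContDiff ℝ 1 fun x => ∑ k, P.S.transpose i k * ζ x k
    exact ContDiff.sum fun k _ => contDiff_const.mul (contDiff_odeSol _ _ _ _ (hξ k))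
  have hbc : P.AdjointBoundaryCondition (η 0) (η 1) := by
    rw [adjointBoundaryCondition_iff_dual]
    intro k
    simp only [hdual]
    have h1 : ∀ k, ζ (P.out k) k = h k := fun k => by simp [hζ, odeSol]
    rw [h1, hh]
    rfl
  refine ⟨⟨η, hηc, hbc⟩, ?_⟩
  ext1 x
  refine P.dual_injective (funext fun k => ?_)
  have h1 : P.dual (deriv η x) k
      = l / P.lam k * ζ x k - P.dual (ξ x) k / P.lam k := by
    have h2 := P.hasDerivAt_dual ⟨η, hηc, hbc⟩ k x
    simp only [hdual] at h2
    exact h2.unique (hasDerivAt_odeSol _ _ _ _ (hξ k) x)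
  have h3 : P.dual ((l • P.testFun ⟨η, hηc, hbc⟩
      - matMap P.L.transpose (P.testDeriv ⟨η, hηc, hbc⟩)) x) k
      = l * P.dual (η x) k - P.dual (P.L.transpose.toEuclideanLin (deriv η x)) k := by
    rw [← P.dual_smul]
    exact (P.dualCLM k).map_sub _ _
  rw [h3, dual_L_transpose, h1, hdual]
  field_simp [P.lam_ne_zero k]
  ring

/-- A test function as an element of `L²`. -/
def testL2 : P.testSpace →ₗ[ℝ] L2 n := toL2 ∘ₗ P.testFun

/-- The adjoint operator, applied to a test function, as an element of `L²`. -/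
def adjL2 : P.testSpace →ₗ[ℝ] L2 n :=
  toL2 ∘ₗ (matMap P.L.transpose ∘ₗ P.testDeriv + matMap P.A.transpose ∘ₗ P.testFun)

theorem testL2_separating (f : L2 n) (h : ∀ η, inner ℝ (P.testL2 η) f = 0) : f = 0 := by
  refine eq_zero_of_inner_contDiff f fun g hg e h0 h1 => ?_
  exact h ⟨fun x => g x • e, hg.smul contDiff_const, fun u₀ u₁ _ => by simp [h0, h1]⟩

theorem mulL2_toChar_ofChar (κ : ℝ) (f : L2 n) :
    mulL2 (P.toChar κ) (mulL2 (P.ofChar κ) f) = f := mulL2_mulL2_cancel (P.toChar_ofChar κ) f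

theorem mulL2_ofChar_toChar (κ : ℝ) (f : L2 n) :
    mulL2 (P.ofChar κ) (mulL2 (P.toChar κ) f) = f := mulL2_mulL2_cancel (P.ofChar_toChar κ) f

/-- In weighted characteristic variables, the adjoint operator of a mode is quasi-dissipative. -/
theorem exists_dissipativePair : ∃ (κ : ℝ) (D : DissipativePair (L2 n) P.testSpace),
    (∀ η, D.p η = mulL2 (P.toChar κ) (P.testL2 η)) ∧
      ∀ η, D.q η = mulL2 (P.toChar κ) (P.adjL2 η) := by
  obtain ⟨κ, hκ, hb⟩ := P.exists_exp_bound
  set M := mulL2 (P.toChar κ) with hM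
  set M' := mulL2 (P.ofChar κ) with hM'
  let D : DissipativePair (L2 n) P.testSpace :=
    { p := M.toLinearMap ∘ₗ P.testL2
      q := M.toLinearMap ∘ₗ toL2 ∘ₗ matMap P.L.transpose ∘ₗ P.testDeriv
      ω := κ * ∑ k, P.speed k
      ω_nonneg := mul_nonneg hκ (Finset.sum_nonneg fun k _ => (P.speed_pos k).le)
      separating := fun f hf => by
        have h1 := P.testL2_separating (ContinuousLinearMap.adjoint M f) fun η => by
          rw [ContinuousLinearMap.adjoint_inner_right]; exact hf η
        refine ext_inner_right ℝ fun g => ?_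
        rw [← P.mulL2_toChar_ofChar κ g, ← hM, ← ContinuousLinearMap.adjoint_inner_left, h1,
          inner_zero_left, inner_zero_left]
      dissipative := P.dissipative_transport hκ hb
      denseRange := fun l hl => by
        refine denseRange_toL2.mono ?_
        rintro _ ⟨f, rfl⟩
        obtain ⟨η, hη⟩ := P.exists_test_eq hκ hb hl
          ⟨fun x => P.ofChar κ x (f x), (P.ofChar κ).continuous.clm_apply f.continuous⟩
        refine ⟨η, ?_⟩
        have h1 : (l • (M.toLinearMap ∘ₗ P.testL2)
            - M.toLinearMap ∘ₗ toL2 ∘ₗ matMap P.L.transpose ∘ₗ P.testDeriv) η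
            = M (toL2 (l • P.testFun η - matMap P.L.transpose (P.testDeriv η))) := by
          rw [map_sub, map_smul, map_sub, map_smul]; rfl
        rw [h1, hη, ← mulL2_toL2, P.mulL2_toChar_ofChar] }
  let N : C(ℝ, EuclideanSpace ℝ (Fin n) →L[ℝ] EuclideanSpace ℝ (Fin n)) :=
    ContinuousMap.const ℝ (Matrix.toEuclideanCLM (𝕜 := ℝ) P.A.transpose)
  -- The source term enters as multiplication by `Aᵀ`, conjugated to the weighted variables.
  refine ⟨κ, D.addBounded (M ∘L mulL2 N ∘L M'), fun η => rfl, fun η => ?_⟩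
  have h1 : (M ∘L mulL2 N ∘L M') (D.p η) = M (toL2 (matMap P.A.transpose (P.testFun η))) := by
    change M (mulL2 N (M' (M (toL2 (P.testFun η))))) = _
    rw [hM', hM, P.mulL2_ofChar_toChar, mulL2_toL2]
    rfl
  change D.q η + (M ∘L mulL2 N ∘L M') (D.p η) = _
  have h2 : P.adjL2 η = toL2 (matMap P.L.transpose (P.testDeriv η))
      + toL2 (matMap P.A.transpose (P.testFun η)) := map_add toL2 _ _
  rw [h1, h2, map_add]
  rfl

/-- The test side was transformed by a multiplier `M`, so an abstract orbit `y` corresponds to `M*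
y`; the datum is transformed by the adjoint of `M⁻¹`. -/
theorem exists_orbit (w : L2 n) :
    ∃ u : ℝ → L2 n, Continuous u ∧ u 0 = w ∧ ∀ η, ∀ t, 0 ≤ t →
      inner ℝ (P.testL2 η) (u t) - inner ℝ (P.testL2 η) w
        = ∫ s in (0 : ℝ)..t, inner ℝ (P.adjL2 η) (u s) := by
  obtain ⟨κ, D, hp, hq⟩ := P.exists_dissipativePair
  obtain ⟨y, hyc, hy0, hy⟩ :=
    D.exists_orbit (ContinuousLinearMap.adjoint (mulL2 (P.ofChar κ)) w)
  have h0 : ContinuousLinearMap.adjoint (mulL2 (P.toChar κ))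
      (ContinuousLinearMap.adjoint (mulL2 (P.ofChar κ)) w) = w := by
    refine ext_inner_right ℝ fun g => ?_
    rw [ContinuousLinearMap.adjoint_inner_left, ContinuousLinearMap.adjoint_inner_left,
      P.mulL2_ofChar_toChar]
  refine ⟨fun t => ContinuousLinearMap.adjoint (mulL2 (P.toChar κ)) (y t), by fun_prop,
    by simp only [hy0, h0], fun η t ht => ?_⟩
  have h := hy η t ht
  simp only [hp, hq, ← ContinuousLinearMap.adjoint_inner_right, h0] at h
  exact h

theorem orbit_unique {u : ℝ → L2 n} (hu : Continuous u) {T : ℝ}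
    (h : ∀ η, ∀ t ∈ Icc 0 T,
      inner ℝ (P.testL2 η) (u t) = ∫ s in (0 : ℝ)..t, inner ℝ (P.adjL2 η) (u s))
    {t : ℝ} (ht : t ∈ Icc 0 T) : u t = 0 := by
  obtain ⟨κ, D, hp, hq⟩ := P.exists_dissipativePair
  have h1 := D.orbit_unique (u := fun t => ContinuousLinearMap.adjoint (mulL2 (P.ofChar κ)) (u t))
    (by fun_prop) (T := T) (fun η t ht => by
      simp only [hp, hq, ContinuousLinearMap.adjoint_inner_right, P.mulL2_ofChar_toChar]
      exact h η t ht) ht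
  refine ext_inner_right ℝ fun g => ?_
  rw [← P.mulL2_ofChar_toChar κ g, ← ContinuousLinearMap.adjoint_inner_left, h1, inner_zero_left,
    inner_zero_left]

end Mode
end SwitchedHyperbolic

/-! ### From stationary to time-dependent test functions. -/

namespace SwitchedHyperbolic

variable {n : ℕ}

theorem eventually_norm_sub_lt {F : ℝ × ℝ → EuclideanSpace ℝ (Fin n)} (hF : Continuous F) (t₀ : ℝ)
    {ε : ℝ} (hε : 0 < ε) : ∀ᶠ t in 𝓝 t₀, ∀ x ∈ Icc (0 : ℝ) 1, ‖F (t, x) - F (t₀, x)‖ < ε := by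
  have h := (ContinuousMap.curry ⟨F, hF⟩).continuous.tendsto t₀
  rw [ContinuousMap.tendsto_iff_forall_isCompact_tendstoUniformlyOn] at h
  filter_upwards [Metric.tendstoUniformlyOn_iff.1 (h _ isCompact_Icc) ε hε] with t ht x hx
  rw [← dist_eq_norm, dist_comm]
  exact ht x hx

theorem continuous_toL2_slice {F : ℝ × ℝ → EuclideanSpace ℝ (Fin n)} (hF : Continuous F) :
    Continuous fun t => toL2 (ContinuousMap.curry ⟨F, hF⟩ t) := by
  refine continuous_iff_continuousAt.2 fun t₀ => Metric.tendsto_nhds.2 fun ε hε => ?_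
  filter_upwards [eventually_norm_sub_lt hF t₀ (half_pos hε)] with t ht
  rw [dist_eq_norm, ← map_sub]
  refine lt_of_le_of_lt (norm_toL2_le (half_pos hε).le fun x hx => ?_) (half_lt_self hε)
  rw [ContinuousMap.sub_apply, ContinuousMap.curry_apply, ContinuousMap.curry_apply]
  exact (ht x hx).le

theorem hasDerivAt_toL2_slice {F F' : ℝ × ℝ → EuclideanSpace ℝ (Fin n)} (hF : Continuous F)
    (hF' : Continuous F') (hd : ∀ t x, HasDerivAt (fun s => F (s, x)) (F' (t, x)) t) (t₀ : ℝ) :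
    HasDerivAt (fun t => toL2 (ContinuousMap.curry ⟨F, hF⟩ t))
      (toL2 (ContinuousMap.curry ⟨F', hF'⟩ t₀)) t₀ := by
  rw [hasDerivAt_iff_isLittleO, Asymptotics.isLittleO_iff]
  intro c hc
  obtain ⟨δ, hδ, h⟩ := Metric.eventually_nhds_iff_ball.1 (eventually_norm_sub_lt hF' t₀ hc)
  filter_upwards [Metric.ball_mem_nhds t₀ hδ] with s hs
  rw [← map_sub, ← map_smul, ← map_sub]
  refine norm_toL2_le (by positivity) fun x hx => ?_
  have hg : ∀ r ∈ Metric.ball t₀ δ, HasDerivWithinAt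
      (fun r => F (r, x) - (r - t₀) • F' (t₀, x)) (F' (r, x) - F' (t₀, x)) (Metric.ball t₀ δ) r := by
    intro r _
    have h1 := ((hasDerivAt_id r).sub_const t₀).smul_const (F' (t₀, x))
    rw [one_smul] at h1
    exact ((hd r x).sub h1).hasDerivWithinAt
  have := (convex_ball t₀ δ).norm_image_sub_le_of_norm_hasDerivWithin_le hg
    (fun r hr => (h r hr x hx).le) (Metric.mem_ball_self hδ) hs
  simp only [sub_self, zero_smul, sub_zero] at this
  rw [ContinuousMap.sub_apply, ContinuousMap.sub_apply, ContinuousMap.smul_apply,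
    ContinuousMap.curry_apply, ContinuousMap.curry_apply, ContinuousMap.curry_apply,
    sub_right_comm]
  exact this

/-- A product rule without differentiability of `u`: since `k t = 0`, the difference quotient is the
slope of `k` paired with `u s`. -/
theorem _root_.HasDerivAt.inner_of_continuousAt {K : Type*} [NormedAddCommGroup K]
    [InnerProductSpace ℝ K] {k u : ℝ → K} {k' : K} {t : ℝ} (hk : HasDerivAt k k' t) (hk0 : k t = 0)
    (hu : ContinuousAt u t) : HasDerivAt (fun s => inner ℝ (k s) (u s)) (inner ℝ k' (u t)) t := by
  rw [hasDerivAt_iff_tendsto_slope] at hk ⊢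
  refine (hk.inner (hu.tendsto.mono_left nhdsWithin_le_nhds)).congr fun s => ?_
  simp [slope, hk0, inner_smul_left]

theorem hasDerivAt_time {φ : ℝ → ℝ → EuclideanSpace ℝ (Fin n)}
    (hφ : ContDiff ℝ 1 (fun q : ℝ × ℝ => φ q.1 q.2)) (t x : ℝ) :
    HasDerivAt (fun s => φ s x)
    (fderiv ℝ (fun q : ℝ × ℝ => φ q.1 q.2) (t, x) (1, 0)) t := by
  have h := (hφ.differentiable one_ne_zero (t, x)).hasFDerivAt
  exact h.comp_hasDerivAt t ((hasDerivAt_id t).prodMk (hasDerivAt_const t x))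

theorem hasDerivAt_space {φ : ℝ → ℝ → EuclideanSpace ℝ (Fin n)}
    (hφ : ContDiff ℝ 1 (fun q : ℝ × ℝ => φ q.1 q.2)) (t x : ℝ) :
    HasDerivAt (fun y => φ t y)
    (fderiv ℝ (fun q : ℝ × ℝ => φ q.1 q.2) (t, x) (0, 1)) x := by
  have h := (hφ.differentiable one_ne_zero (t, x)).hasFDerivAt
  exact h.comp_hasDerivAt x ((hasDerivAt_const x t).prodMk (hasDerivAt_id x))

theorem continuous_deriv_time {φ : ℝ → ℝ → EuclideanSpace ℝ (Fin n)}
    (hφ : ContDiff ℝ 1 (fun q : ℝ × ℝ => φ q.1 q.2)) :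
    Continuous fun q : ℝ × ℝ => deriv (fun s => φ s q.2) q.1 := by
  simp only [fun q : ℝ × ℝ => (hasDerivAt_time hφ q.1 q.2).deriv]
  exact (hφ.continuous_fderiv one_ne_zero).clm_apply continuous_const

theorem continuous_deriv_space {φ : ℝ → ℝ → EuclideanSpace ℝ (Fin n)}
    (hφ : ContDiff ℝ 1 (fun q : ℝ × ℝ => φ q.1 q.2)) :
    Continuous fun q : ℝ × ℝ => deriv (fun y => φ q.1 y) q.2 := by
  simp only [fun q : ℝ × ℝ => (hasDerivAt_space hφ q.1 q.2).deriv]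
  exact (hφ.continuous_fderiv one_ne_zero).clm_apply continuous_const

theorem continuous_adjointOperator {φ : ℝ → ℝ → EuclideanSpace ℝ (Fin n)}
    (hφ : ContDiff ℝ 1 (fun q : ℝ × ℝ => φ q.1 q.2)) (P : Mode n) :
    Continuous fun q : ℝ × ℝ => P.adjointOperator φ q.1 q.2 :=
  ((continuous_deriv_time hφ).add
    ((Matrix.toEuclideanCLM (𝕜 := ℝ) P.L.transpose).continuous.comp
      (continuous_deriv_space hφ))).add
    ((Matrix.toEuclideanCLM (𝕜 := ℝ) P.A.transpose).continuous.comp hφ.continuous)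

/-- The weak formulation of a single mode on `[a,b]`, for stationary test functions. -/
def Stationary (P : Mode n) (u : ℝ → L2 n) (a b : ℝ) : Prop :=
  ∀ η, ∀ t ∈ Icc a b, inner ℝ (P.testL2 η) (u t) - inner ℝ (P.testL2 η) (u a)
    = ∫ s in a..t, inner ℝ (P.adjL2 η) (u s)

theorem Stationary.shift {P : Mode n} {u : ℝ → L2 n} {a b : ℝ} (h : Stationary P u a b) (c : ℝ) :
    Stationary P (fun s => u (s + c)) (a - c) (b - c) := by
  intro η t ht
  have h1 := h η (t + c) ⟨by linarith [ht.1], by linarith [ht.2]⟩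
  rw [intervalIntegral.integral_comp_add_right (fun s => inner ℝ (P.adjL2 η) (u s)),
    sub_add_cancel]
  simpa only [sub_add_cancel] using h1

theorem Stationary.eq {P : Mode n} {u v : ℝ → L2 n} {a b : ℝ} (hu : Stationary P u a b)
    (hv : Stationary P v a b) (huc : Continuous u) (hvc : Continuous v) (h0 : u a = v a) {t : ℝ}
    (ht : t ∈ Icc a b) : u t = v t := by
  have hu' := hu.shift a
  have hv' := hv.shift a
  rw [sub_self] at hu' hv'
  have := P.orbit_unique (u := fun s => u (s + a) - v (s + a)) (by fun_prop) (T := b - a)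
    (fun η t ht => by
      have h1 := hu' η t ht
      have h2 := hv' η t ht
      simp only [zero_add, ← h0] at h1 h2
      simp only [inner_sub_right]
      rw [intervalIntegral.integral_sub (Continuous.intervalIntegrable (by fun_prop) _ _)
        (Continuous.intervalIntegrable (by fun_prop) _ _), ← h1, ← h2]
      ring) (t := t - a) ⟨by linarith [ht.1], by linarith [ht.2]⟩
  simpa [sub_eq_zero] using this

/-- At a fixed `t`, write `φ(s) = (φ(s) - φ(t)) + φ(t)`. The first part vanishes at `s = t`, so
continuity of `u` suffices to differentiate its pairing; the second is a stationary test function,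
admissible by the boundary condition at time `t`. The fundamental theorem of calculus concludes. -/
theorem Stationary.weak {P : Mode n} {u : ℝ → L2 n} {a b : ℝ} (hab : a ≤ b)
    (hu : Stationary P u a b) (huc : Continuous u) {φ : ℝ → ℝ → EuclideanSpace ℝ (Fin n)}
    (hφ : ContDiff ℝ 1 (fun q : ℝ × ℝ => φ q.1 q.2))
    (hbc : ∀ t ∈ Ico a b, P.AdjointBoundaryCondition (φ t 0) (φ t 1)) :
    (Continuous fun t => ∫ x in Ioo (0 : ℝ) 1, inner ℝ (P.adjointOperator φ t x) (u t x)) ∧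
    (∫ x in Ioo (0 : ℝ) 1, inner ℝ (φ b x) (u b x))
        - (∫ x in Ioo (0 : ℝ) 1, inner ℝ (φ a x) (u a x))
      = ∫ t in a..b, ∫ x in Ioo (0 : ℝ) 1, inner ℝ (P.adjointOperator φ t x) (u t x) := by
  set F : C(ℝ × ℝ, EuclideanSpace ℝ (Fin n)) := ⟨fun q => φ q.1 q.2, hφ.continuous⟩ with hF
  set Ft : C(ℝ × ℝ, EuclideanSpace ℝ (Fin n)) :=
    ⟨fun q => deriv (fun s => φ s q.2) q.1, continuous_deriv_time hφ⟩ with hFt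
  set Q : C(ℝ × ℝ, EuclideanSpace ℝ (Fin n)) :=
    ⟨fun q => P.adjointOperator φ q.1 q.2, continuous_adjointOperator hφ P⟩ with hQ
  have e1 : ∀ t, ∫ x in Ioo (0 : ℝ) 1, inner ℝ (φ t x) (u t x)
      = inner ℝ (toL2 (F.curry t)) (u t) := fun t => (inner_toL2 (F.curry t) (u t)).symm
  have e2 : ∀ t, ∫ x in Ioo (0 : ℝ) 1, inner ℝ (P.adjointOperator φ t x) (u t x)
      = inner ℝ (toL2 (Q.curry t)) (u t) := fun t => (inner_toL2 (Q.curry t) (u t)).symm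
  simp only [e1, e2]
  have hFc : Continuous fun t => toL2 (F.curry t) := continuous_toL2_slice F.continuous
  have hQc : Continuous fun t => toL2 (Q.curry t) := continuous_toL2_slice Q.continuous
  have hcont : Continuous fun t => inner ℝ (toL2 (Q.curry t)) (u t) := hQc.inner huc
  refine ⟨hcont, ?_⟩
  refine (intervalIntegral.integral_eq_sub_of_hasDeriv_right (f := fun t =>
    inner ℝ (toL2 (F.curry t)) (u t)) (hFc.inner huc).continuousOn (fun t ht => ?_)
    (hcont.intervalIntegrable _ _)).symm
  rw [min_eq_left hab, max_eq_right hab] at ht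
  refine HasDerivAt.hasDerivWithinAt ?_
  have hFd : HasDerivAt (fun t => toL2 (F.curry t)) (toL2 (Ft.curry t)) t :=
    hasDerivAt_toL2_slice F.continuous Ft.continuous
      (fun t x => (hasDerivAt_time hφ t x).differentiableAt.hasDerivAt) t
  have h1 := HasDerivAt.inner_of_continuousAt (hFd.sub_const (toL2 (F.curry t))) (sub_self _)
    huc.continuousAt
  have hφt : ContDiff ℝ 1 (φ t) := hφ.comp (contDiff_const.prodMk contDiff_id)
  set η : P.testSpace := ⟨φ t, hφt, hbc t ⟨ht.1.le, ht.2⟩⟩ with hη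
  have h2 : HasDerivAt (fun s => inner ℝ (P.testL2 η) (u s)) (inner ℝ (P.adjL2 η) (u t)) t := by
    have hc : Continuous fun s => inner ℝ (P.adjL2 η) (u s) := by fun_prop
    have h3 := (intervalIntegral.integral_hasDerivAt_right (hc.intervalIntegrable a t)
      (hc.stronglyMeasurableAtFilter _ _) hc.continuousAt).const_add (inner ℝ (P.testL2 η) (u a))
    refine h3.congr_of_eventuallyEq ?_
    filter_upwards [Icc_mem_nhds ht.1 ht.2] with s hs
    rw [← hu η s hs]; ring
  have h4 := h1.add h2
  have e3 : toL2 (Q.curry t) = toL2 (Ft.curry t) + P.adjL2 η := by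
    rw [Mode.adjL2, LinearMap.comp_apply, ← map_add]
    congr 1
    ext1 x
    exact add_assoc _ _ _
  rw [e3, inner_add_left]
  refine h4.congr_of_eventuallyEq (.of_forall fun s => ?_)
  have e4 : P.testL2 η = toL2 (F.curry t) := rfl
  simp only [Pi.add_apply, e4, inner_sub_left]
  ring

/-- The weak formulation implies the one for stationary test functions. -/
theorem stationary_of_weak {P : Mode n} {u : ℝ → L2 n} {a b : ℝ}
    (h : ∀ t ∈ Icc a b, ∀ φ : ℝ → ℝ → EuclideanSpace ℝ (Fin n),
      ContDiff ℝ 1 (fun q : ℝ × ℝ => φ q.1 q.2) →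
      (∀ t, P.AdjointBoundaryCondition (φ t 0) (φ t 1)) →
      (∫ x in Ioo (0 : ℝ) 1, inner ℝ (φ t x) (u t x))
          - (∫ x in Ioo (0 : ℝ) 1, inner ℝ (φ a x) (u a x))
        = ∫ s in a..t, ∫ x in Ioo (0 : ℝ) 1, inner ℝ (P.adjointOperator φ s x) (u s x)) :
    Stationary P u a b := by
  intro η t ht
  have h1 := h t ht (fun _ => η.1) (η.2.1.comp contDiff_snd) fun _ => η.2.2
  have e1 : ∀ t, inner ℝ (P.testL2 η) (u t) = ∫ x in Ioo (0 : ℝ) 1, inner ℝ (η.1 x) (u t x) :=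
    fun t => inner_toL2 _ _
  rw [e1, e1, h1]
  refine intervalIntegral.integral_congr fun s _ => ?_
  refine Eq.trans ?_ (inner_toL2 _ _).symm
  simp only [Mode.adjointOperator, deriv_const, zero_add]
  rfl

end SwitchedHyperbolic

/-! ### Gluing over the switching times. -/

namespace SwitchedHyperbolic

variable {n : ℕ} {I : Type*}

/-- The identity of the weak formulation on `[a,b]` for the test function `φ`. -/
def WeakIdentity (P : I → Mode n) (σ : ℝ≥0 → I) (w : C(ℝ≥0, L2 n)) (a b : ℝ≥0)
    (φ : ℝ → ℝ → EuclideanSpace ℝ (Fin n)) : Prop :=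
  (∫ x in Ioo (0 : ℝ) 1, inner ℝ (φ b x) (w b x))
      - (∫ x in Ioo (0 : ℝ) 1, inner ℝ (φ a x) (w a x))
    = ∫ t in (a : ℝ)..b, ∫ x in Ioo (0 : ℝ) 1,
        inner ℝ ((P (σ t.toNNReal)).adjointOperator φ t x) (w t.toNNReal x)

/-- The weak formulation on `[a,b]`, together with the integrability of its right-hand side. -/
def WeakOn (P : I → Mode n) (σ : ℝ≥0 → I) (w : C(ℝ≥0, L2 n)) (a b : ℝ≥0) : Prop :=
  ∀ φ : ℝ → ℝ → EuclideanSpace ℝ (Fin n), ContDiff ℝ 1 (fun q : ℝ × ℝ => φ q.1 q.2) →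
    (∀ t ∈ Ico a b, (P (σ t)).AdjointBoundaryCondition (φ t 0) (φ t 1)) →
    IntervalIntegrable (fun t : ℝ => ∫ x in Ioo (0 : ℝ) 1,
      inner ℝ ((P (σ t.toNNReal)).adjointOperator φ t x) (w t.toNNReal x)) volume a b ∧
    WeakIdentity P σ w a b φ

theorem WeakOn.congr {P : I → Mode n} {σ : ℝ≥0 → I} {w w' : C(ℝ≥0, L2 n)} {a b : ℝ≥0}
    (hab : a ≤ b) (hw : WeakOn P σ w a b) (h : ∀ t ∈ Icc a b, w t = w' t) : WeakOn P σ w' a b := by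
  intro φ hφ hbc
  obtain ⟨h1, h2⟩ := hw φ hφ hbc
  have hab' : (a : ℝ) ≤ b := hab
  have h3 : ∀ t ∈ Ioo (a : ℝ) b, (∫ x in Ioo (0 : ℝ) 1,
      inner ℝ ((P (σ t.toNNReal)).adjointOperator φ t x) (w t.toNNReal x))
      = ∫ x in Ioo (0 : ℝ) 1,
      inner ℝ ((P (σ t.toNNReal)).adjointOperator φ t x) (w' t.toNNReal x) := by
    intro t ht
    rw [h t.toNNReal ⟨NNReal.le_toNNReal_of_coe_le ht.1.le, Real.toNNReal_le_iff_le_coe.2 ht.2.le⟩]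
  refine ⟨h1.congr_uIoo (by rwa [uIoo_of_le hab']), ?_⟩
  rw [WeakIdentity] at h2 ⊢
  rw [← h a (left_mem_Icc.2 hab), ← h b (right_mem_Icc.2 hab), h2]
  exact intervalIntegral.integral_congr_Ioo_of_le hab' h3

theorem WeakOn.trans {P : I → Mode n} {σ : ℝ≥0 → I} {w : C(ℝ≥0, L2 n)} {a b c : ℝ≥0}
    (hab : a ≤ b) (hbc : b ≤ c) (h1 : WeakOn P σ w a b) (h2 : WeakOn P σ w b c) :
    WeakOn P σ w a c := by
  intro φ hφ hφbc
  obtain ⟨i1, e1⟩ := h1 φ hφ fun t ht => hφbc t ⟨ht.1, ht.2.trans_le hbc⟩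
  obtain ⟨i2, e2⟩ := h2 φ hφ fun t ht => hφbc t ⟨hab.trans ht.1, ht.2⟩
  refine ⟨i1.trans i2, ?_⟩
  rw [WeakIdentity] at e1 e2 ⊢
  rw [← intervalIntegral.integral_add_adjacent_intervals i1 i2, ← e1, ← e2]
  ring

theorem Stationary.weakOn {P : I → Mode n} {σ : ℝ≥0 → I} {w : C(ℝ≥0, L2 n)} {a b : ℝ≥0}
    (hab : a ≤ b) {i : I} (hσ : ∀ t ∈ Ico a b, σ t = i) {u : ℝ → L2 n} (huc : Continuous u)
    (hu : Stationary (P i) u a b) (hw : ∀ t ∈ Icc a b, w t = u t) : WeakOn P σ w a b := by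
  intro φ hφ hbc
  have hab' : (a : ℝ) ≤ b := hab
  obtain ⟨h1, h2⟩ := hu.weak hab' huc hφ fun t ht => by
    lift t to ℝ≥0 using a.2.trans ht.1
    have ht' : t ∈ Ico a b := ⟨by exact_mod_cast ht.1, by exact_mod_cast ht.2⟩
    have := hbc t ht'
    rwa [hσ t ht'] at this
  have h3 : ∀ t ∈ Ioo (a : ℝ) b,
      (∫ x in Ioo (0 : ℝ) 1, inner ℝ ((P i).adjointOperator φ t x) (u t x))
      = ∫ x in Ioo (0 : ℝ) 1,
      inner ℝ ((P (σ t.toNNReal)).adjointOperator φ t x) (w t.toNNReal x) := by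
    intro t ht
    lift t to ℝ≥0 using a.2.trans ht.1.le
    have ht' : t ∈ Ico a b := ⟨by exact_mod_cast ht.1.le, by exact_mod_cast ht.2⟩
    rw [Real.toNNReal_coe, hσ t ht', hw t (Ico_subset_Icc_self ht')]
  refine ⟨(h1.intervalIntegrable _ _).congr_uIoo (by rwa [uIoo_of_le hab']), ?_⟩
  rw [WeakIdentity, hw a (left_mem_Icc.2 hab), hw b (right_mem_Icc.2 hab), h2]
  exact intervalIntegral.integral_congr_Ioo_of_le hab' h3

theorem stationary_of_weakIdentity {P : I → Mode n} {σ : ℝ≥0 → I} {w : C(ℝ≥0, L2 n)} {a b : ℝ≥0}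
    {i : I} (hσ : ∀ t ∈ Ico a b, σ t = i)
    (h : ∀ t ∈ Icc a b, ∀ φ : ℝ → ℝ → EuclideanSpace ℝ (Fin n),
      ContDiff ℝ 1 (fun q : ℝ × ℝ => φ q.1 q.2) →
      (∀ s ∈ Ico a t, (P (σ s)).AdjointBoundaryCondition (φ s 0) (φ s 1)) →
      WeakIdentity P σ w a t φ) :
    Stationary (P i) (fun s => w s.toNNReal) a b := by
  refine stationary_of_weak fun t ht φ hφ hbc => ?_
  lift t to ℝ≥0 using a.2.trans ht.1
  have ht' : t ∈ Icc a b := ⟨by exact_mod_cast ht.1, by exact_mod_cast ht.2⟩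
  have h1 := h t ht' φ hφ fun s hs => by
    rw [hσ s ⟨hs.1, hs.2.trans_le ht'.2⟩]; exact hbc s
  rw [WeakIdentity] at h1
  rw [Real.toNNReal_coe, Real.toNNReal_coe, h1]
  refine intervalIntegral.integral_congr_Ioo_of_le ht.1 fun s hs => ?_
  lift s to ℝ≥0 using a.2.trans hs.1.le
  rw [Real.toNNReal_coe, hσ s ⟨by exact_mod_cast hs.1.le, by
    have : s < t := by exact_mod_cast hs.2
    exact this.trans_le ht'.2⟩]

theorem WeakOn.stationary {P : I → Mode n} {σ : ℝ≥0 → I} {w : C(ℝ≥0, L2 n)} {a b : ℝ≥0} {i : I}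
    (hσ : ∀ t ∈ Ico a b, σ t = i) (h : ∀ t ∈ Icc a b, WeakOn P σ w a t) :
    Stationary (P i) (fun s => w s.toNNReal) a b :=
  stationary_of_weakIdentity hσ fun t ht φ hφ hbc => (h t ht φ hφ hbc).2

theorem IsWeakSolution.stationary {P : I → Mode n} {σ : ℝ≥0 → I} {w₀ : L2 n} {w : C(ℝ≥0, L2 n)}
    (hw : IsWeakSolution P σ w₀ w) {a b : ℝ≥0} {i : I} (hσ : ∀ t ∈ Ico a b, σ t = i) :
    Stationary (P i) (fun s => w s.toNNReal) a b :=
  stationary_of_weakIdentity hσ fun t ht φ hφ hbc => hw.weak_form a t ht.1 φ hφ hbc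

theorem IsSwitchingSignal.exists_Ico_right {σ : ℝ≥0 → I} (hσ : IsSwitchingSignal σ) (t : ℝ≥0) :
    ∃ r > t, ∀ s ∈ Ico t r, σ s = σ t :=
  (mem_nhdsGE_iff_exists_Ico_subset' (lt_add_one t)).1 (hσ.right_continuous t)

/-- Finitely many switching times leave a gap just before `t`; there the signal is locally constant,
hence constant on a connected interval. The time `t` is excluded, as it may be a switching time
itself. -/
theorem IsSwitchingSignal.exists_Ico_left {σ : ℝ≥0 → I} (hσ : IsSwitchingSignal σ) {t : ℝ≥0}
    (ht : 0 < t) : ∃ r < t, ∀ s ∈ Ico r t, σ s = σ r := by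
  have hfin : ((switchingTimes σ ∩ Iic t) \ {t}).Finite := (hσ.finite_switchingTimes t).sdiff
  have hmem : ((switchingTimes σ ∩ Iic t) \ {t})ᶜ ∈ 𝓝 t :=
    hfin.isClosed.isOpen_compl.mem_nhds fun h => h.2 rfl
  obtain ⟨r, hr, hsub⟩ := exists_Ioc_subset_of_mem_nhds hmem ⟨0, ht⟩
  obtain ⟨r', hr', hr't⟩ := exists_between hr
  refine ⟨r', hr't, fun s hs => ?_⟩
  let _ : TopologicalSpace I := ⊥
  have : DiscreteTopology I := ⟨rfl⟩
  refine isPreconnected_Ico.constant (fun x hx => ?_) hs (left_mem_Ico.2 hr't)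
  have hx1 := hsub ⟨hr'.trans_le hx.1, hx.2.le⟩
  have hx2 : x ∉ switchingTimes σ := fun h => hx1 ⟨⟨h, hx.2.le⟩, hx.2.ne⟩
  have hx3 : ∀ᶠ s in 𝓝 x, σ s = σ x := not_not.1 hx2
  exact (continuousAt_const.congr (hx3.mono fun s hs => hs.symm)).continuousWithinAt

/-- Two continuous functions that solve the unswitched problems between the switching times
coincide. -/
theorem eq_of_stationary {P : I → Mode n} {σ : ℝ≥0 → I} (hσ : IsSwitchingSignal σ)
    {w w' : C(ℝ≥0, L2 n)} {T : ℝ≥0}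
    (hw : ∀ (a b : ℝ≥0) (i : I), b ≤ T → (∀ t ∈ Ico a b, σ t = i) →
      Stationary (P i) (fun s => w s.toNNReal) a b)
    (hw' : ∀ (a b : ℝ≥0) (i : I), b ≤ T → (∀ t ∈ Ico a b, σ t = i) →
      Stationary (P i) (fun s => w' s.toNNReal) a b)
    (h0 : w 0 = w' 0) {t : ℝ≥0} (ht : t ≤ T) : w t = w' t := by
  -- Continuous induction: the coincidence set is closed, and uniqueness for the active mode pushes
  -- it to the right.
  have hcl : IsClosed ({t | w t = w' t} ∩ Icc 0 T) :=
    (isClosed_eq w.continuous w'.continuous).inter isClosed_Icc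
  refine hcl.Icc_subset_of_forall_exists_gt h0 (fun x hx y hy => ?_) ⟨zero_le, ht⟩
  obtain ⟨r, hr, hconst⟩ := hσ.exists_Ico_right x
  set z := min (min y r) T with hz
  have hxz : x < z := lt_min (lt_min hy hr) hx.2.2
  refine ⟨z, ?_, hxz, (min_le_left _ _).trans (min_le_left _ _)⟩
  have hc : ∀ t ∈ Ico x z, σ t = σ x := fun t ht =>
    hconst t ⟨ht.1, ht.2.trans_le ((min_le_left _ _).trans (min_le_right _ _))⟩
  have hzT : z ≤ T := min_le_right _ _
  have := (hw x z _ hzT hc).eq (hw' x z _ hzT hc) (w.continuous.comp continuous_real_toNNReal)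
    (w'.continuous.comp continuous_real_toNNReal)
    (by rw [Real.toNNReal_coe]; exact hx.1) (t := z)
    (right_mem_Icc.2 (by exact_mod_cast hxz.le))
  rwa [Real.toNNReal_coe] at this

/-- A weak solution on `[0,T]` extends over an interval without switching. -/
theorem exists_extension (P : I → Mode n) {σ : ℝ≥0 → I} {w : C(ℝ≥0, L2 n)} {T T' : ℝ≥0}
    (hw : ∀ a b, a ≤ b → b ≤ T → WeakOn P σ w a b) {i : I}
    (hσ : ∀ t ∈ Ico T T', σ t = i) :
    ∃ w' : C(ℝ≥0, L2 n), w' 0 = w 0 ∧ ∀ a b, a ≤ b → b ≤ T' → WeakOn P σ w' a b := by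
  obtain ⟨u, huc, hu0, hu⟩ := (P i).exists_orbit (w T)
  set v : ℝ → L2 n := fun t => u (t - T) with hv
  have hvc : Continuous v := by fun_prop
  have hstat : ∀ b : ℝ, Stationary (P i) v T b := by
    intro b
    have h1 : Stationary (P i) u 0 (b - T) := fun η t ht => by rw [hu0]; exact hu η t ht.1
    have := h1.shift (-(T : ℝ))
    simpa only [sub_neg_eq_add, sub_add_cancel, ← sub_eq_add_neg, zero_add] using this
  have hvT : v T = w T := by simp [hv, hu0]
  let w' : C(ℝ≥0, L2 n) := ⟨fun t => if t ≤ T then w t else v t,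
    Continuous.if_le w.continuous (by fun_prop) continuous_id continuous_const
      fun t ht => by rw [ht, hvT]⟩
  have h1 : ∀ t ≤ T, w' t = w t := fun t ht => if_pos ht
  have h2 : ∀ t, T ≤ t → w' t = v t := fun t ht => by
    rcases ht.eq_or_lt with rfl | h
    · rw [h1 _ le_rfl, hvT]
    · exact if_neg h.not_ge
  have hold : ∀ a b, a ≤ b → b ≤ T → WeakOn P σ w' a b := fun a b hab hb =>
    (hw a b hab hb).congr hab fun t ht => (h1 t (ht.2.trans hb)).symm
  have hnew : ∀ a b, a ≤ b → T ≤ a → b ≤ T' → WeakOn P σ w' a b := by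
    intro a b hab ha hb
    refine Stationary.weakOn hab (i := i)
      (fun t ht => hσ t ⟨ha.trans ht.1, ht.2.trans_le hb⟩) hvc ?_
      fun t ht => h2 t (ha.trans ht.1)
    -- The identity starting at `a` is the difference of two identities starting at `T`.
    intro η t ht
    have ha' : (T : ℝ) ≤ a := ha
    have e1 := hstat t η t ⟨ha'.trans ht.1, le_rfl⟩
    have e2 := hstat a η a ⟨ha', le_rfl⟩
    have hc : Continuous fun s => inner ℝ ((P i).adjL2 η) (v s) := by fun_prop
    rw [← intervalIntegral.integral_interval_sub_left (hc.intervalIntegrable T t)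
      (hc.intervalIntegrable T a), ← e1, ← e2]
    ring
  refine ⟨w', h1 0 zero_le, fun a b hab hb => ?_⟩
  rcases le_total b T with hbT | hbT
  · exact hold a b hab hbT
  rcases le_total T a with haT | haT
  · exact hnew a b hab haT hb
  · exact (hold a T haT le_rfl).trans haT hbT (hnew T b hbT le_rfl hb)

/-- Continuous induction on the horizon: right-continuity of the signal yields progress, and
constancy just before a limit time yields closedness. -/
theorem exists_weakOn (P : I → Mode n) {σ : ℝ≥0 → I} (hσ : IsSwitchingSignal σ) (w₀ : L2 n)
    (T : ℝ≥0) : ∃ w : C(ℝ≥0, L2 n), w 0 = w₀ ∧ ∀ a b, a ≤ b → b ≤ T → WeakOn P σ w a b := by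
  set s : Set ℝ≥0 := {T | ∃ w : C(ℝ≥0, L2 n), w 0 = w₀ ∧
    ∀ a b, a ≤ b → b ≤ T → WeakOn P σ w a b} with hs
  have hext : ∀ t ∈ s, ∀ t', t ≤ t' → (∀ r ∈ Ico t t', σ r = σ t) → t' ∈ s := by
    rintro t ⟨w, h0, hw⟩ t' htt' hc
    obtain ⟨w', h0', hw'⟩ := exists_extension P hw hc
    exact ⟨w', h0'.trans h0, hw'⟩
  have hlow : ∀ t ∈ s, ∀ r ≤ t, r ∈ s := by
    rintro t ⟨w, h0, hw⟩ r hr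
    exact ⟨w, h0, fun a b hab hb => hw a b hab (hb.trans hr)⟩
  have hzero : (0 : ℝ≥0) ∈ s := by
    refine ⟨ContinuousMap.const _ w₀, rfl, fun a b hab hb => ?_⟩
    obtain rfl : b = 0 := le_antisymm hb zero_le
    obtain rfl : a = 0 := le_antisymm hab zero_le
    intro φ _ _
    exact ⟨IntervalIntegrable.refl, by simp [WeakIdentity]⟩
  have hclosed : IsClosed s := by
    refine isClosed_of_closure_subset fun t ht => ?_
    rcases (zero_le (a := t)).eq_or_lt with rfl | h0
    · exact hzero
    obtain ⟨r, hr, hc⟩ := hσ.exists_Ico_left h0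
    obtain ⟨t', ht', hmem⟩ := mem_closure_iff_nhds.1 ht (Ioi r) (Ioi_mem_nhds hr)
    exact hext r (hlow t' hmem r ht'.le) t hr.le hc
  refine (hclosed.inter isClosed_Icc).Icc_subset_of_forall_exists_gt hzero (fun x hx y hy => ?_)
    (right_mem_Icc.2 (zero_le (a := T)))
  obtain ⟨r, hr, hc⟩ := hσ.exists_Ico_right x
  refine ⟨min y r, hext x hx.1 _ (le_min (le_of_lt hy) hr.le) fun t ht =>
    hc t ⟨ht.1, ht.2.trans_le (min_le_right _ _)⟩, lt_min hy hr, min_le_left _ _⟩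

/-- By uniqueness the solutions for different horizons agree on their common range, so the diagonal
`t ↦ W t t` is continuous and solves the problem for all times. -/
theorem exists_isWeakSolution (P : I → Mode n) {σ : ℝ≥0 → I} (hσ : IsSwitchingSignal σ)
    (w₀ : L2 n) : ∃ w : C(ℝ≥0, L2 n), IsWeakSolution P σ w₀ w := by
  choose W hW0 hW using exists_weakOn P hσ w₀
  have hstat : ∀ S T : ℝ≥0, T ≤ S → ∀ (a b : ℝ≥0) (i : I), b ≤ T → (∀ t ∈ Ico a b, σ t = i) →
      Stationary (P i) (fun s => W S s.toNNReal) a b := fun S T hST a b i hb hc =>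
    WeakOn.stationary hc fun t ht => hW S a t ht.1 (ht.2.trans (hb.trans hST))
  have hagree : ∀ S T : ℝ≥0, T ≤ S → ∀ t ≤ T, W S t = W T t := fun S T hST t ht =>
    eq_of_stationary hσ (hstat S T hST) (hstat T T le_rfl) ((hW0 S).trans (hW0 T).symm) ht
  let w : C(ℝ≥0, L2 n) := ⟨fun t => W t t, continuous_iff_continuousAt.2 fun t₀ => by
    refine (W (t₀ + 1)).continuous.continuousAt.congr ?_
    filter_upwards [Iic_mem_nhds (lt_add_one t₀)] with t ht
    exact hagree _ _ ht t le_rfl⟩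
  refine ⟨w, hW0 0, fun a b hab φ hφ hbc => ?_⟩
  exact (((hW b a b hab le_rfl).congr hab fun t ht => hagree b t ht.2 t le_rfl :
    WeakOn P σ w a b) φ hφ hbc).2

theorem IsWeakSolution.eq {P : I → Mode n} {σ : ℝ≥0 → I} (hσ : IsSwitchingSignal σ) {w₀ : L2 n}
    {w w' : C(ℝ≥0, L2 n)} (hw : IsWeakSolution P σ w₀ w) (hw' : IsWeakSolution P σ w₀ w') :
    w = w' :=
  ContinuousMap.ext fun t => eq_of_stationary hσ (T := t) (fun _ _ _ _ hc => hw.stationary hc)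
    (fun _ _ _ _ hc => hw'.stationary hc) (hw.initial.trans hw'.initial.symm) le_rfl

theorem isSwitchingSignal_const (i : I) : IsSwitchingSignal (fun _ : ℝ≥0 => i) where
  right_continuous _ := .of_forall fun _ => rfl
  finite_switchingTimes T := by simp [switchingTimes]

end SwitchedHyperbolic

end

theorem mainTheorem6 {n : ℕ} {I : Type*} [Finite I] (P : I → SwitchedHyperbolic.Mode n)
    (σ : ℝ≥0 → I) (hσ : SwitchedHyperbolic.IsSwitchingSignal σ)
    (w₀ : SwitchedHyperbolic.L2 n) :
    (∃! w : C(ℝ≥0, SwitchedHyperbolic.L2 n), SwitchedHyperbolic.IsWeakSolution P σ w₀ w) ∧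
    ∀ w : C(ℝ≥0, SwitchedHyperbolic.L2 n), SwitchedHyperbolic.IsWeakSolution P σ w₀ w →
      ∀ (a b : ℝ≥0) (i : I), a < b → (∀ t ∈ Ico a b, σ t = i) →
        ∃ v : C(ℝ≥0, SwitchedHyperbolic.L2 n),
          SwitchedHyperbolic.IsWeakSolution P (fun _ => i) (w a) v ∧
            ∀ t ∈ Icc a b, w t = v (t - a) := by
  refine ⟨?_, fun w hw a b i hab hc => ?_⟩
  · obtain ⟨w, hw⟩ := SwitchedHyperbolic.exists_isWeakSolution P hσ w₀
    exact ⟨w, hw, fun w' hw' => hw'.eq hσ hw⟩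
  · obtain ⟨v, hv⟩ := SwitchedHyperbolic.exists_isWeakSolution P
      (SwitchedHyperbolic.isSwitchingSignal_const i) (w a)
    refine ⟨v, hv, fun t ht => ?_⟩
    -- Both `w` and the translate of `v` are weak orbits of mode `i` on `[a,b]` with the same value
    -- at `a`, so uniqueness for one mode identifies them.
    have h1 := hw.stationary hc
    have h2 := (hv.stationary (a := 0) (b := b - a) (i := i) fun _ _ => rfl).shift (-(a : ℝ))
    rw [NNReal.coe_zero, zero_sub, neg_neg, NNReal.coe_sub hab.le, sub_neg_eq_add,
      sub_add_cancel] at h2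
    have h3 := h1.eq h2 (w.continuous.comp continuous_real_toNNReal)
      (v.continuous.comp (continuous_real_toNNReal.comp (by fun_prop)))
      (by simp [hv.initial]) (t := t) ⟨by exact_mod_cast ht.1, by exact_mod_cast ht.2⟩
    rwa [Real.toNNReal_coe, ← sub_eq_add_neg, ← NNReal.coe_sub ht.1, Real.toNNReal_coe] at h3
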